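/- Consider the discrete-time linear system $x_{k+1}=Ax_k+Bu_k$, $y_k=Cx_k+Du_k$, $z_k=Ex_k+Fu_k$ with $x_k\in\mathbb R^{n_x}$, $u_k\in\mathbb R^{n_u}$, $y_k\in\mathbb R^{n_y}$, $z_k\in\mathbb R^{n_z}$, a target reference $r\in\mathbb R^{n_z}$, a horizon $N\ge 1$ and a margin $\epsilon\in(0,1)$. Let the columns of $G=[G_x^T\ G_u^T\ G_z^T]^T$ (with $n_z$ columns) be a basis of the kernel of $$Z=\begin{bmatrix}A-I&B&0\\E&F&-I\end{bmatrix},$$ and put $\bar x_v=G_xv$, $\bar u_v=G_uv$ for $v\in\mathbb R^{n_z}$. Assume: (1) $(A,B)$ is stabilizable; (2) $G_z$ is invertible; (3) $\mathcal Y=\{y\mid Yy\le h\}$ is a compact polyhedron with $0\in\operatorname{Int}\mathcal Y$; (4) $Q\succeq0$ with $(A,Q)$ detectable, and $R\succ0$. Let $P$ be the positive semidefinite solution of the Riccati equation $P=Q+A^TPA-(A^TPB)(R+B^TPB)^{-1}(B^TPA)$, and let $K=(R+B^TPB)^{-1}(B^TPA)$. Let $\mathcal R_\epsilon=\{v\mid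 (CG_x+DG_u)v\in(1-\epsilon)\mathcal Y\}$ and $r^\star=\arg\min_{v\in\mathcal R_\epsilon}\|v-r\|_2$. Let $\mathcal T$ be the set of all $(x,v)$ such that $v\in\mathcal R_\epsilon$ and the trajectory $\tilde x_0=x$, $\tilde x_{j+1}=A\tilde x_j+B\tilde u_j$, $\tilde u_j=\bar u_v-K(\tilde x_j-\bar x_v)$ satisfies $C\tilde x_j+D\tilde u_j\in\mathcal Y$ for all $j\ge0$. For given $(x,v)$ consider the optimal control problem of minimizing $$\|\xi_N-\bar x_v\|_P^2+\sum_{i=0}^{N-1}\left(\|\xi_i-\bar x_v\|_Q^2+\|\mu_i-\bar u_v\|_R^2\right)$$ over $\mu=(\mu_0,\dots,\mu_{N-1})$ subject to $\xi_0=x$, $\xi_{i+1}=A\xi_i+B\mu_i$ and $C\xi_i+D\mu_i\in\mathcal Y$ for $0\le i\le N-1$, and $(\xi_N,v)\in\mathcal T$, where $\|w\|_M^2=w^TMw$. Let $\Gamma_N$ be the set of $(x,v)$ for which it is feasible, let $\kappa(x,v)=\mu_0^\star$ be the first input of its minimizer, and let $\Lambda=\Gamma_N\cap(\mathbb R^{n_x}\times\mathcal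 R_\epsilon)$. Let $g(x)=\arg\min\{\|v-r\|_2^2\mid v\in\mathcal R_\epsilon,\ (x,v)\in\Gamma_N\}$ and consider the closed loop $$v_k=g(x_k),\qquad x_{k+1}=Ax_k+B\,\kappa(x_k,v_k).$$ Then $r^\star$ is well defined and, for every $x_0$ in the projection of $\Lambda$ onto the state coordinates, the closed-loop sequence is well defined (at every step both optimization problems have a unique minimizer) and there is a finite time $t\ge0$ such that $v_k=r^\star$ for all $k\ge t$. -/

import Mathlib

open scoped Matrix Pointwise

noncomputable section

namespace FeasGov

/-- A real square matrix is Schur (discrete-time stable) if all its complex eigenvalues lie in the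
open unit disc. -/
def IsSchur {n : ℕ} (M : Matrix (Fin n) (Fin n) ℝ) : Prop :=
  ∀ z ∈ spectrum ℂ (M.map (algebraMap ℝ ℂ)), ‖z‖ < 1

/-- `(A, B)` is stabilizable: some linear state feedback makes the closed loop Schur. -/
def IsStabilizable {n m : ℕ} (A : Matrix (Fin n) (Fin n) ℝ) (B : Matrix (Fin n) (Fin m) ℝ) : Prop :=
  ∃ K : Matrix (Fin m) (Fin n) ℝ, IsSchur (A - B * K)

/-- `(A, H)` is detectable: some output injection makes the error dynamics Schur. -/
def IsDetectable {n m : ℕ} (A : Matrix (Fin n) (Fin n) ℝ) (H : Matrix (Fin m) (Fin n) ℝ) : Prop :=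
  ∃ L : Matrix (Fin n) (Fin m) ℝ, IsSchur (A - L * H)

/-- The squared weighted norm `‖x‖²_M = xᵀ M x`. -/
def wsq {n : ℕ} (M : Matrix (Fin n) (Fin n) ℝ) (x : Fin n → ℝ) : ℝ := x ⬝ᵥ (M *ᵥ x)

/-- The Euclidean norm on `ℝⁿ`. -/
def enorm2 {n : ℕ} (x : Fin n → ℝ) : ℝ := ‖(WithLp.toLp 2 x : EuclideanSpace ℝ (Fin n))‖

/-- `a` minimizes `f` over `S`. -/
def IsMinimizer {α : Type*} (f : α → ℝ) (S : Set α) (a : α) : Prop := a ∈ S ∧ IsMinOn f S a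

/-- A minimizer of `f` over `S` (an arbitrary point if there is none). -/
def argmin {α : Type*} [Nonempty α] (f : α → ℝ) (S : Set α) : α :=
  Classical.epsilon (IsMinimizer f S)

/-- The data: the system matrices, the parameterization `(Gx, Gu, Gz)` of the equilibria,
the half-space representation `Y y ≤ h` of the constraint set, the margin `ε`, the weights
`Q`, `R`, `P`, and the target reference `r`. No property is assumed here. -/
structure Setup (nx nu ny nz m : ℕ) where
  A : Matrix (Fin nx) (Fin nx) ℝ
  B : Matrix (Fin nx) (Fin nu) ℝ
  C : Matrix (Fin ny) (Fin nx) ℝ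
  D : Matrix (Fin ny) (Fin nu) ℝ
  E : Matrix (Fin nz) (Fin nx) ℝ
  F : Matrix (Fin nz) (Fin nu) ℝ
  Gx : Matrix (Fin nx) (Fin nz) ℝ
  Gu : Matrix (Fin nu) (Fin nz) ℝ
  Gz : Matrix (Fin nz) (Fin nz) ℝ
  Y : Matrix (Fin m) (Fin ny) ℝ
  h : Fin m → ℝ
  ε : ℝ
  Q : Matrix (Fin nx) (Fin nx) ℝ
  R : Matrix (Fin nu) (Fin nu) ℝ
  P : Matrix (Fin nx) (Fin nx) ℝ
  r : Fin nz → ℝ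

namespace Setup

variable {nx nu ny nz m : ℕ} (S : Setup nx nu ny nz m)

/-- The matrix `Z` whose kernel consists of the equilibria `(x, u, z)`. -/
def Z : Matrix (Fin nx ⊕ Fin nz) (Fin nx ⊕ (Fin nu ⊕ Fin nz)) ℝ :=
  Matrix.fromRows
    (Matrix.fromCols (S.A - 1) (Matrix.fromCols S.B 0))
    (Matrix.fromCols S.E (Matrix.fromCols S.F (-1)))

/-- The stacked matrix `G = [Gx; Gu; Gz]`. -/
def G : Matrix (Fin nx ⊕ (Fin nu ⊕ Fin nz)) (Fin nz) ℝ :=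
  Matrix.fromRows S.Gx (Matrix.fromRows S.Gu S.Gz)

/-- The columns of `G` form a basis of `ker Z`. -/
def IsEquilibriumBasis : Prop :=
  LinearIndependent ℝ (fun j i => S.G i j) ∧
    Submodule.span ℝ (Set.range (fun j i => S.G i j)) = LinearMap.ker S.Z.mulVecLin

/-- The equilibrium state `x̄_v`. -/
def xbar (v : Fin nz → ℝ) : Fin nx → ℝ := S.Gx *ᵥ v

/-- The equilibrium input `ū_v`. -/
def ubar (v : Fin nz → ℝ) : Fin nu → ℝ := S.Gu *ᵥ v

/-- The constraint set `{y | Y y ≤ h}`. -/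
def constraintSet : Set (Fin ny → ℝ) := {y | S.Y *ᵥ y ≤ S.h}

/-- The strictly steady-state admissible references `R_ε`. -/
def admissibleRefs : Set (Fin nz → ℝ) :=
  {v | (S.C * S.Gx + S.D * S.Gu) *ᵥ v ∈ (1 - S.ε) • S.constraintSet}

/-- The best admissible approximation `r⋆` of `r`. -/
def rStar : Fin nz → ℝ := argmin (fun v => enorm2 (v - S.r)) S.admissibleRefs

/-- `P` solves the discrete algebraic Riccati equation. -/
def SolvesDARE : Prop :=
  S.P = S.Q + S.Aᵀ * S.P * S.A
    - (S.Aᵀ * S.P * S.B) * (S.R + S.Bᵀ * S.P * S.B)⁻¹ * (S.Bᵀ * S.P * S.A)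

/-- The LQR gain. -/
def K : Matrix (Fin nu) (Fin nx) ℝ :=
  (S.R + S.Bᵀ * S.P * S.B)⁻¹ * (S.Bᵀ * S.P * S.A)

/-- The LQR tracking law `u = ū_v - K (x - x̄_v)` for a constant reference `v`. -/
def lqrInput (v : Fin nz → ℝ) (x : Fin nx → ℝ) : Fin nu → ℝ :=
  S.ubar v - S.K *ᵥ (x - S.xbar v)

/-- The state trajectory from `x` under the LQR tracking law with constant reference `v`. -/
def lqrState (x : Fin nx → ℝ) (v : Fin nz → ℝ) : ℕ → Fin nx → ℝ
  | 0 => x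
  | j + 1 => S.A *ᵥ lqrState x v j + S.B *ᵥ S.lqrInput v (lqrState x v j)

/-- The terminal set: the maximal output admissible set of the LQR loop with constant reference,
with the steady-state output tightened by the factor `1 - ε`. -/
def terminalSet : Set ((Fin nx → ℝ) × (Fin nz → ℝ)) :=
  {p | S.C *ᵥ S.xbar p.2 + S.D *ᵥ S.ubar p.2 ∈ (1 - S.ε) • S.constraintSet ∧
    ∀ j : ℕ, S.C *ᵥ S.lqrState p.1 p.2 j + S.D *ᵥ S.lqrInput p.2 (S.lqrState p.1 p.2 j)
      ∈ S.constraintSet}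

variable {N : ℕ}

/-- The predicted states `ξ_0, …, ξ_N` from `x` under the input sequence `μ`. -/
def predState (x : Fin nx → ℝ) (μ : Fin N → Fin nu → ℝ) : Fin (N + 1) → Fin nx → ℝ :=
  Fin.induction x (fun i ξ => S.A *ᵥ ξ + S.B *ᵥ μ i)

/-- The input sequences that are feasible for the optimal control problem at `(x, v)`. -/
def ocpFeasible (N : ℕ) (x : Fin nx → ℝ) (v : Fin nz → ℝ) : Set (Fin N → Fin nu → ℝ) :=
  {μ | (∀ i : Fin N, S.C *ᵥ S.predState x μ i.castSucc + S.D *ᵥ μ i ∈ S.constraintSet) ∧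
    (S.predState x μ (Fin.last N), v) ∈ S.terminalSet}

/-- The cost of the optimal control problem at `(x, v)`. -/
def ocpCost (x : Fin nx → ℝ) (v : Fin nz → ℝ) (μ : Fin N → Fin nu → ℝ) : ℝ :=
  wsq S.P (S.predState x μ (Fin.last N) - S.xbar v) +
    ∑ i : Fin N, (wsq S.Q (S.predState x μ i.castSucc - S.xbar v) + wsq S.R (μ i - S.ubar v))

/-- The feasible set `Γ_N` of the optimal control problem. -/
def Gam (N : ℕ) : Set ((Fin nx → ℝ) × (Fin nz → ℝ)) :=
  {p | (S.ocpFeasible N p.1 p.2).Nonempty}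

/-- The MPC feedback policy `κ(x, v)`: the first input of the minimizer. -/
def mpc (N : ℕ) [NeZero N] (x : Fin nx → ℝ) (v : Fin nz → ℝ) : Fin nu → ℝ :=
  argmin (S.ocpCost x v) (S.ocpFeasible N x v) 0

/-- The MPC closed loop `f(x, v) = A x + B κ(x, v)`. -/
def step (N : ℕ) [NeZero N] (x : Fin nx → ℝ) (v : Fin nz → ℝ) : Fin nx → ℝ :=
  S.A *ᵥ x + S.B *ᵥ S.mpc N x v

/-- The references among which the feasibility governor chooses at the state `x`. -/
def govFeasible (N : ℕ) (x : Fin nx → ℝ) : Set (Fin nz → ℝ) :=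
  {v | v ∈ S.admissibleRefs ∧ (x, v) ∈ S.Gam N}

/-- The objective of the feasibility governor. -/
def govCost (v : Fin nz → ℝ) : ℝ := enorm2 (v - S.r) ^ 2

/-- The feasibility governor `g(x, r)`. -/
def gov (N : ℕ) (x : Fin nx → ℝ) : Fin nz → ℝ := argmin S.govCost (S.govFeasible N x)

/-- The feasible set `Λ = Γ_N ∩ (ℝⁿ × R_ε)` of the feasibility governor. -/
def Lam (N : ℕ) : Set ((Fin nx → ℝ) × (Fin nz → ℝ)) :=
  S.Gam N ∩ (Set.univ ×ˢ S.admissibleRefs)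

/-- The closed-loop states `x_{k+1} = f(x_k, g(x_k, r))`. -/
def stateSeq (N : ℕ) [NeZero N] (x₀ : Fin nx → ℝ) : ℕ → Fin nx → ℝ
  | 0 => x₀
  | k + 1 => S.step N (stateSeq N x₀ k) (S.gov N (stateSeq N x₀ k))

/-- The auxiliary references `v_k = g(x_k, r)` along the closed loop. -/
def refSeq (N : ℕ) [NeZero N] (x₀ : Fin nx → ℝ) (k : ℕ) : Fin nz → ℝ :=
  S.gov N (S.stateSeq N x₀ k)

end Setup

end FeasGov

end

/-!
While the reference `v` is constant, the optimal value plus a storage function supplied by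
detectability decreases by a multiple of `‖x - x̄_v‖²`. Two facts keep a moving reference under
control. The terminal set is cut out by finitely many output constraints, so `Γ_N` is the
projection of a polyhedron and feasible inputs can be chosen Lipschitz-continuously in `(x, v)`:
replacing `v` by `v'` raises the value by at most a small multiple of `‖x - x̄_v‖²` plus a large
multiple of `‖v' - v‖²`. The previous reference stays feasible and the governor projects `r` onto a
convex set, so `‖v_{k+1} - v_k‖²` is at most the decrease of `‖v_k - r‖²`. Adding a large multiple
of `‖v_k - r‖²` therefore gives a Lyapunov function, and `x_k - x̄_{v_k} → 0`. Once this error is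
small, every admissible `v` near `v_k` is feasible at `x_k`, so `v_k` minimizes `‖v - r‖` over
`R_ε` locally, hence globally by convexity.
-/

noncomputable section

namespace FeasGov

open Filter Topology

section QuadraticForm

variable {E : Type*} [AddCommGroup E] [Module ℝ E] {q : QuadraticForm ℝ E}

lemma quadraticForm_add_smul (q : QuadraticForm ℝ E) (x y : E) (t : ℝ) :
    q (x + t • y) = q x + t * QuadraticMap.polar q x y + t ^ 2 * q y := by
  rw [QuadraticMap.map_add q, QuadraticMap.map_smul, QuadraticMap.polar_smul_right, smul_eq_mul,
    smul_eq_mul]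
  ring

/-- Young's inequality: expand `0 ≤ q (η • x - y)`. -/
lemma quadraticForm_add_le (hq : ∀ x, 0 ≤ q x) {η : ℝ} (hη : 0 < η) (x y : E) :
    q (x + y) ≤ (1 + η) * q x + (1 + η⁻¹) * q y := by
  have hyoung : 0 ≤ η⁻¹ * q (y + (-η) • x) := mul_nonneg (inv_nonneg.2 hη.le) (hq _)
  have hpolar : QuadraticMap.polar q x y ≤ η * q x + η⁻¹ * q y := by
    rw [quadraticForm_add_smul, QuadraticMap.polar_comm] at hyoung
    field_simp at hyoung ⊢
    linarith
  rw [QuadraticMap.map_add q]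
  linarith

lemma quadraticForm_add_le_two (hq : ∀ x, 0 ≤ q x) (x y : E) :
    q (x + y) ≤ 2 * q x + 2 * q y := by
  have h := quadraticForm_add_le hq one_pos x y
  norm_num at h
  linarith

lemma isMinimizer_quadratic_gain {V : Type*} [AddCommGroup V] [Module ℝ V] {l : V →ₗ[ℝ] E} {p : E}
    {s : Set V} (hs : Convex ℝ s) {a b : V} (ha : IsMinimizer (fun v => q (p + l v)) s a)
    (hb : b ∈ s) : q (l (b - a)) ≤ q (p + l b) - q (p + l a) := by
  set d := l (b - a) with hd
  have hfirstOrder : 0 ≤ QuadraticMap.polar q (p + l a) d := by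
    have hslope : ∀ᶠ t : ℝ in 𝓝[>] 0, 0 ≤ QuadraticMap.polar q (p + l a) d + t * q d := by
      filter_upwards [Ioc_mem_nhdsGT (zero_lt_one' ℝ)] with t ht
      have hmin : q (p + l a) ≤ q (p + l (a + t • (b - a))) :=
        ha.2 (hs.add_smul_sub_mem ha.1 hb ⟨ht.1.le, ht.2⟩)
      rw [map_add l, map_smul l, ← add_assoc, quadraticForm_add_smul] at hmin
      exact nonneg_of_mul_nonneg_right (by linarith) ht.1
    have hlim : Tendsto (fun t : ℝ => QuadraticMap.polar q (p + l a) d + t * q d) (𝓝[>] 0)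
        (𝓝 (QuadraticMap.polar q (p + l a) d + 0 * q d)) :=
      (Continuous.tendsto (by fun_prop) 0).mono_left nhdsWithin_le_nhds
    simpa only [zero_mul, add_zero] using ge_of_tendsto hlim hslope
  have hexpand : q (p + l b) = q (p + l a) + QuadraticMap.polar q (p + l a) d + q d := by
    rw [show p + l b = (p + l a) + d by rw [hd, map_sub]; abel, QuadraticMap.map_add q]
    ring
  linarith

end QuadraticForm

section FiniteDimensionalQuadraticForm

variable {E V : Type*} [NormedAddCommGroup E] [NormedSpace ℝ E] [FiniteDimensional ℝ E]
  [NormedAddCommGroup V] [NormedSpace ℝ V] [FiniteDimensional ℝ V] {q : QuadraticForm ℝ E}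

lemma quadraticForm_continuous (q : QuadraticForm ℝ E) : Continuous q := by
  have hB : Continuous fun x => QuadraticMap.polarBilin q x x := by
    have := LinearMap.continuous_of_finiteDimensional
      (LinearMap.toContinuousLinearMap.toLinearMap ∘ₗ QuadraticMap.polarBilin q)
    exact this.clm_apply continuous_id
  refine (hB.const_smul (2⁻¹ : ℝ)).congr fun x => ?_
  simp

lemma exists_quadraticForm_le (q : QuadraticForm ℝ E) :
    ∃ C, 0 < C ∧ ∀ x, q x ≤ C * ‖x‖ ^ 2 := by
  obtain ⟨C, hC⟩ := (isCompact_closedBall (0 : E) 1).exists_bound_of_continuousOn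
    (quadraticForm_continuous q).continuousOn
  refine ⟨max C 1, by positivity, fun x => ?_⟩
  rcases eq_or_ne x 0 with rfl | hx
  · simp
  have hnorm : ‖x‖ ≠ 0 := norm_ne_zero_iff.2 hx
  have hunit : q (‖x‖⁻¹ • x) ≤ max C 1 :=
    (le_abs_self _).trans ((hC _ (by simp [norm_smul, hnorm])).trans (le_max_left _ _))
  calc q x = q (‖x‖⁻¹ • x) * ‖x‖ ^ 2 := by
        rw [QuadraticMap.map_smul, smul_eq_mul]; field_simp
    _ ≤ max C 1 * ‖x‖ ^ 2 := by gcongr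

lemma exists_le_quadraticForm_of_posDef (hq : q.PosDef) :
    ∃ c, 0 < c ∧ ∀ x, c * ‖x‖ ^ 2 ≤ q x := by
  rcases subsingleton_or_nontrivial E with hE | hE
  · exact ⟨1, one_pos, fun x => by simp [Subsingleton.elim x 0]⟩
  obtain ⟨y, hy, hmin⟩ := (isCompact_sphere (0 : E) 1).exists_isMinOn
    (NormedSpace.sphere_nonempty.2 zero_le_one) (quadraticForm_continuous q).continuousOn
  refine ⟨q y, hq y (ne_zero_of_mem_unit_sphere ⟨y, hy⟩), fun x => ?_⟩
  rcases eq_or_ne x 0 with rfl | hx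
  · simp
  have hnorm : ‖x‖ ≠ 0 := norm_ne_zero_iff.2 hx
  have hunit : q y ≤ q (‖x‖⁻¹ • x) := hmin (by simp [norm_smul, hnorm])
  calc q y * ‖x‖ ^ 2 ≤ q (‖x‖⁻¹ • x) * ‖x‖ ^ 2 := by gcongr
    _ = q x := by rw [QuadraticMap.map_smul, smul_eq_mul]; field_simp

lemma existsUnique_isMinimizer_quadratic (hq : ∀ x, 0 ≤ q x) {l : V →ₗ[ℝ] E}
    (hql : (q.comp l).PosDef) (p : E) {s : Set V} (hs : Convex ℝ s) (hsc : IsClosed s)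
    (hne : s.Nonempty) : ∃! v, IsMinimizer (fun v => q (p + l v)) s v := by
  obtain ⟨c, hc, hcq⟩ := exists_le_quadraticForm_of_posDef hql
  obtain ⟨v₀, hv₀⟩ := hne
  have hl : Continuous l := l.continuous_of_finiteDimensional
  have hcont : Continuous fun v => q (p + l v) :=
    (quadraticForm_continuous q).comp (continuous_const.add hl)
  have hcoercive : Tendsto (fun v => q (p + l v)) (cocompact V) atTop := by
    have hlower (v : V) : c * ‖v‖ ^ 2 ≤ 2 * q (p + l v) + 2 * q p := by
      have h := quadraticForm_add_le_two hq (p + l v) (-p)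
      rw [QuadraticMap.map_neg, show p + l v + -p = l v by abel] at h
      exact (hcq v).trans h
    refine tendsto_atTop_mono (f := fun v => c / 2 * ‖v‖ ^ 2 - q p)
      (fun v => by linarith [hlower v]) ?_
    exact tendsto_atTop_add_const_right _ _ (((tendsto_pow_atTop two_ne_zero).comp
      (tendsto_norm_cocompact_atTop (E := V))).const_mul_atTop (by positivity))
  obtain ⟨v, hv, hmin⟩ := hcont.continuousOn.exists_isMinOn' hsc hv₀
    ((hcoercive.eventually_ge_atTop _).filter_mono inf_le_left)
  refine ⟨v, ⟨hv, hmin⟩, fun w hw => ?_⟩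
  by_contra hvw
  have hgain := isMinimizer_quadratic_gain hs ⟨hv, hmin⟩ hw.1
  have hle : q (p + l w) ≤ q (p + l v) := hw.2 hv
  have hpos : 0 < q (l (w - v)) := hql (w - v) (sub_ne_zero.2 hvw)
  linarith

end FiniteDimensionalQuadraticForm

section WeightedNorm

variable {n : ℕ} {M : Matrix (Fin n) (Fin n) ℝ}

lemma toQuadraticForm'_eq_wsq (M : Matrix (Fin n) (Fin n) ℝ) (x : Fin n → ℝ) :
    M.toQuadraticForm' x = wsq M x := by
  rw [Matrix.toQuadraticForm', LinearMap.BilinMap.toQuadraticMap_apply,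
    Matrix.toLinearMap₂'_apply', wsq]

lemma wsq_nonneg (hM : M.PosSemidef) (x : Fin n → ℝ) : 0 ≤ wsq M x := by
  simpa [wsq] using hM.dotProduct_mulVec_nonneg x

lemma wsq_pos (hM : M.PosDef) {x : Fin n → ℝ} (hx : x ≠ 0) : 0 < wsq M x := by
  simpa [wsq] using hM.dotProduct_mulVec_pos hx

lemma wsq_zero (M : Matrix (Fin n) (Fin n) ℝ) : wsq M 0 = 0 := by
  simp only [wsq, zero_dotProduct]

lemma enorm2_sq (x : Fin n → ℝ) : enorm2 x ^ 2 = wsq 1 x := by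
  rw [enorm2, EuclideanSpace.real_norm_sq_eq]
  simp [wsq, dotProduct, sq]

end WeightedNorm

lemma argmin_isMinimizer {α : Type*} [Nonempty α] {f : α → ℝ} {s : Set α}
    (h : ∃ a, IsMinimizer f s a) : IsMinimizer f s (argmin f s) :=
  Classical.epsilon_spec h

/-- A polyhedron, possibly unbounded or empty: the solution set of finitely many affine
inequalities. -/
def IsPolyhedron {E : Type*} [AddCommGroup E] [Module ℝ E] (s : Set E) : Prop :=
  ∃ T : Set (E →ᵃ[ℝ] ℝ), T.Finite ∧ s = {x | ∀ f ∈ T, f x ≤ 0}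

/-- Every point of a fibre of `s` can be moved into any other nonempty fibre by a displacement
proportional to the displacement of the base point. For polyhedra this is Hoffman's error bound; it
moves feasible inputs along with the state and the reference. -/
def HasLipschitzFibres {E F : Type*} [NormedAddCommGroup E] [NormedAddCommGroup F]
    (s : Set (E × F)) : Prop :=
  ∃ L, 0 ≤ L ∧ ∀ p t, (p, t) ∈ s → ∀ p' t₀, (p', t₀) ∈ s →
    ∃ t', (p', t') ∈ s ∧ ‖t' - t‖ ≤ L * ‖p' - p‖

namespace IsPolyhedron

section Algebraic

variable {E F : Type*} [AddCommGroup E] [Module ℝ E] [AddCommGroup F] [Module ℝ F]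

lemma preimage {s : Set E} (hs : IsPolyhedron s) (g : F →ᵃ[ℝ] E) : IsPolyhedron (g ⁻¹' s) := by
  obtain ⟨T, hT, rfl⟩ := hs
  refine ⟨(fun f => f.comp g) '' T, hT.image _, ?_⟩
  ext x
  simp only [Set.preimage_ofPred_eq, Set.mem_ofPred_eq, Set.forall_mem_image, AffineMap.comp_apply]

lemma iInter {ι : Type*} [Finite ι] {s : ι → Set E} (hs : ∀ i, IsPolyhedron (s i)) :
    IsPolyhedron (⋂ i, s i) := by
  choose T hT hsT using hs
  refine ⟨⋃ i, T i, Set.finite_iUnion hT, ?_⟩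
  ext x
  simp only [hsT, Set.mem_iInter, Set.mem_ofPred_eq, Set.mem_iUnion, forall_exists_index]
  exact forall_comm

lemma inter {s t : Set E} (hs : IsPolyhedron s) (ht : IsPolyhedron t) :
    IsPolyhedron (s ∩ t) := by
  obtain ⟨T, hT, rfl⟩ := hs
  obtain ⟨U, hU, rfl⟩ := ht
  refine ⟨T ∪ U, hT.union hU, ?_⟩
  ext x
  simp only [Set.mem_inter_iff, Set.mem_ofPred_eq, Set.mem_union, or_imp, forall_and]

lemma convex {s : Set E} (hs : IsPolyhedron s) : Convex ℝ s := by
  obtain ⟨T, -, rfl⟩ := hs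
  simp only [Set.ofPred_forall]
  exact convex_iInter₂ fun f _ => (convex_Iic (0 : ℝ)).affine_preimage f

lemma fibre {s : Set (E × F)} (hs : IsPolyhedron s) (x : E) : IsPolyhedron (Prod.mk x ⁻¹' s) := by
  convert hs.preimage ((LinearMap.inr ℝ E F).toAffineMap + AffineMap.const ℝ F (x, 0)) using 1
  ext y
  simp

end Algebraic

lemma isClosed {E : Type*} [NormedAddCommGroup E] [NormedSpace ℝ E] [FiniteDimensional ℝ E]
    {s : Set E} (hs : IsPolyhedron s) : IsClosed s := by
  obtain ⟨T, -, rfl⟩ := hs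
  simp only [Set.ofPred_forall]
  exact isClosed_biInter fun f _ => isClosed_le f.continuous_of_finiteDimensional continuous_const

end IsPolyhedron

section Elimination

variable {E F : Type*}

lemma nonempty_upperBounds_inter_lowerBounds {s t : Set ℝ} (hs : s.Finite) (ht : t.Finite)
    (hst : ∀ a ∈ s, ∀ b ∈ t, a ≤ b) : (upperBounds s ∩ lowerBounds t).Nonempty := by
  rcases s.eq_empty_or_nonempty with rfl | hsne
  · rw [upperBounds_empty, Set.univ_inter]
    exact ht.bddBelow
  rcases t.eq_empty_or_nonempty with rfl | htne
  · rw [lowerBounds_empty, Set.inter_univ]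
    exact hs.bddAbove
  exact exists_between_of_forall_le hsne htne hst

lemma IsPolyhedron.exists_solved_form [AddCommGroup E] [Module ℝ E] {s : Set (E × ℝ)}
    (hs : IsPolyhedron s) :
    ∃ Z lower upper : Set (E →ᵃ[ℝ] ℝ), Z.Finite ∧ lower.Finite ∧ upper.Finite ∧
      ∀ p t, (p, t) ∈ s ↔
        (∀ f ∈ Z, f p ≤ 0) ∧ (∀ f ∈ lower, f p ≤ t) ∧ ∀ f ∈ upper, t ≤ f p := by
  obtain ⟨T, hT, rfl⟩ := hs
  let a (f : E × ℝ →ᵃ[ℝ] ℝ) : E →ᵃ[ℝ] ℝ := f.comp (LinearMap.inl ℝ E ℝ).toAffineMap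
  let b (f : E × ℝ →ᵃ[ℝ] ℝ) : ℝ := f.linear (0, 1)
  have hf (f : E × ℝ →ᵃ[ℝ] ℝ) (p : E) (t : ℝ) : f (p, t) = a f p + t * b f := by
    have h := f.map_vadd (p, 0) (t • (0, 1))
    rw [map_smul] at h
    simpa [a, b, add_comm] using h
  let root (f : E × ℝ →ᵃ[ℝ] ℝ) : E →ᵃ[ℝ] ℝ := (-(b f)⁻¹) • a f
  have hneg (f) (hb : b f < 0) (p t) : f (p, t) ≤ 0 ↔ root f p ≤ t := by
    have hroot : root f p = -a f p / b f := by simp [root]; ring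
    rw [hroot, hf, div_le_iff_of_neg hb]
    constructor <;> intro h <;> linarith
  have hpos (f) (hb : 0 < b f) (p t) : f (p, t) ≤ 0 ↔ t ≤ root f p := by
    have hroot : root f p = -a f p / b f := by simp [root]; ring
    rw [hroot, hf, le_div_iff₀ hb]
    constructor <;> intro h <;> linarith
  have hzero (f) (hb : b f = 0) (p t) : f (p, t) ≤ 0 ↔ a f p ≤ 0 := by
    rw [hf, hb, mul_zero, add_zero]
  refine ⟨a '' {f ∈ T | b f = 0}, root '' {f ∈ T | b f < 0}, root '' {f ∈ T | 0 < b f},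
    (hT.sep _).image _, (hT.sep _).image _, (hT.sep _).image _, fun p t => ?_⟩
  simp only [Set.forall_mem_image, Set.mem_ofPred_eq, and_imp]
  constructor
  · intro h
    exact ⟨fun f hfT hb => (hzero f hb p t).1 (h f hfT),
      fun f hfT hb => (hneg f hb p t).1 (h f hfT), fun f hfT hb => (hpos f hb p t).1 (h f hfT)⟩
  · rintro ⟨hZ, hl, hu⟩ f hfT
    rcases lt_trichotomy (b f) 0 with hb | hb | hb
    exacts [(hneg f hb p t).2 (hl hfT hb), (hzero f hb p t).2 (hZ hfT hb),
      (hpos f hb p t).2 (hu hfT hb)]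

/-- Fourier–Motzkin elimination of one variable. -/
lemma IsPolyhedron.image_fst_real [AddCommGroup E] [Module ℝ E] {s : Set (E × ℝ)}
    (hs : IsPolyhedron s) : IsPolyhedron (Prod.fst '' s) := by
  obtain ⟨Z, lower, upper, hZ, hlower, hupper, hmem⟩ := hs.exists_solved_form
  refine ⟨Z ∪ Set.image2 (fun f g => f - g) lower upper,
    hZ.union (hlower.image2 _ hupper), ?_⟩
  ext p
  simp only [Set.mem_image, Prod.exists, exists_and_right, exists_eq_right, hmem,
    Set.mem_ofPred_eq, Set.mem_union, or_imp, forall_and, Set.forall_mem_image2,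
    AffineMap.coe_sub, Pi.sub_apply, sub_nonpos]
  constructor
  · rintro ⟨t, hZp, hl, hu⟩
    exact ⟨hZp, fun f hf g hg => (hl f hf).trans (hu g hg)⟩
  · rintro ⟨hZp, hlu⟩
    obtain ⟨t, htl, htu⟩ := nonempty_upperBounds_inter_lowerBounds
      (hlower.image fun f => f p) (hupper.image fun f => f p)
      (by simpa only [Set.forall_mem_image] using hlu)
    exact ⟨t, hZp, fun f hf => htl ⟨f, hf, rfl⟩, fun f hf => htu ⟨f, hf, rfl⟩⟩

lemma exists_lipschitz_of_finite_affineMap [NormedAddCommGroup E] [NormedSpace ℝ E]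
    [FiniteDimensional ℝ E] {T : Set (E →ᵃ[ℝ] ℝ)} (hT : T.Finite) :
    ∃ L, 0 ≤ L ∧ ∀ f ∈ T, ∀ x y, |f y - f x| ≤ L * ‖y - x‖ := by
  obtain ⟨L, hL⟩ := (hT.image fun f => ‖LinearMap.toContinuousLinearMap f.linear‖).bddAbove
  refine ⟨max L 0, le_max_right _ _, fun f hf x y => ?_⟩
  have hle : ‖LinearMap.toContinuousLinearMap f.linear‖ ≤ max L 0 :=
    (hL ⟨f, hf, rfl⟩).trans (le_max_left _ _)
  calc |f y - f x| = ‖LinearMap.toContinuousLinearMap f.linear (y - x)‖ := by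
        rw [LinearMap.coe_toContinuousLinearMap', ← vsub_eq_sub y x, f.linearMap_vsub,
          vsub_eq_sub, Real.norm_eq_abs]
    _ ≤ max L 0 * ‖y - x‖ := ContinuousLinearMap.le_of_opNorm_le _ hle _

lemma IsPolyhedron.hasLipschitzFibres_real [NormedAddCommGroup E] [NormedSpace ℝ E]
    [FiniteDimensional ℝ E] {s : Set (E × ℝ)} (hs : IsPolyhedron s) : HasLipschitzFibres s := by
  obtain ⟨Z, lower, upper, -, hlower, hupper, hmem⟩ := hs.exists_solved_form
  obtain ⟨L, hL, hlip⟩ := exists_lipschitz_of_finite_affineMap (hlower.union hupper)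
  refine ⟨L, hL, ?_⟩
  intro p t hpt p' t₀ hpt₀
  obtain ⟨-, hlt, hut⟩ := (hmem p t).1 hpt
  obtain ⟨hZ, hlt₀, hut₀⟩ := (hmem p' t₀).1 hpt₀
  have hmove (f) (hf : f ∈ lower ∪ upper) := abs_le.1 (hlip f hf p p')
  set δ := L * ‖p' - p‖
  have hδ : 0 ≤ δ := by positivity
  -- the point of `[t - δ, t + δ]` nearest to the point `t₀` of the fibre over `p'`
  refine ⟨max (t - δ) (min t₀ (t + δ)), (hmem _ _).2 ⟨hZ, fun f hf => ?_, fun f hf => ?_⟩, ?_⟩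
  · exact le_max_of_le_right (le_min (hlt₀ f hf) (by linarith [hmove f (.inl hf), hlt f hf]))
  · exact max_le (by linarith [hmove f (.inr hf), hut f hf]) (min_le_of_left_le (hut₀ f hf))
  · rw [Real.norm_eq_abs, abs_sub_le_iff, sub_le_iff_le_add, sub_le_comm]
    exact ⟨max_le (by linarith) ((min_le_right _ _).trans_eq (add_comm _ _)), le_max_left _ _⟩

lemma HasLipschitzFibres.of_prodAssoc {G : Type*} [NormedAddCommGroup E] [NormedAddCommGroup F]
    [NormedAddCommGroup G] {s : Set (E × F × G)}
    (hG : HasLipschitzFibres (Equiv.prodAssoc E F G ⁻¹' s))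
    (hF : HasLipschitzFibres (Prod.fst '' (Equiv.prodAssoc E F G ⁻¹' s))) :
    HasLipschitzFibres s := by
  obtain ⟨L₁, hL₁, hlip₁⟩ := hG
  obtain ⟨L₂, hL₂, hlip₂⟩ := hF
  refine ⟨max L₂ (L₁ * max 1 L₂), by positivity, ?_⟩
  rintro p ⟨t, r⟩ hmem p' ⟨t₀, r₀⟩ hmem₀
  obtain ⟨t', ht', hdist₂⟩ := hlip₂ p t ⟨((p, t), r), hmem, rfl⟩ p' t₀ ⟨((p', t₀), r₀), hmem₀, rfl⟩
  obtain ⟨⟨_, r₁⟩, hmem₁, rfl⟩ := ht'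
  obtain ⟨r', hr', hdist₁⟩ := hlip₁ (p, t) r hmem (p', t') r₁ hmem₁
  have hbase : ‖((p', t') : E × F) - (p, t)‖ ≤ max 1 L₂ * ‖p' - p‖ := by
    rw [Prod.mk_sub_mk, Prod.norm_mk, max_mul_of_nonneg _ _ (norm_nonneg _), one_mul]
    exact max_le_max le_rfl hdist₂
  refine ⟨(t', r'), hr', ?_⟩
  rw [Prod.mk_sub_mk, Prod.norm_mk, max_mul_of_nonneg _ _ (norm_nonneg _), mul_assoc]
  exact max_le_max hdist₂ (hdist₁.trans (by gcongr))

lemma HasLipschitzFibres.of_linearEquiv {F' : Type*} [NormedAddCommGroup E]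
    [NormedAddCommGroup F] [NormedSpace ℝ F] [NormedAddCommGroup F'] [NormedSpace ℝ F']
    (e : F' ≃L[ℝ] F) {s : Set (E × F)} (hs : HasLipschitzFibres (Prod.map id e ⁻¹' s)) :
    HasLipschitzFibres s := by
  obtain ⟨L, hL, hlip⟩ := hs
  refine ⟨‖(e : F' →L[ℝ] F)‖ * L, by positivity, ?_⟩
  intro p t hmem p' t₀ hmem₀
  obtain ⟨t', ht', hdist⟩ := hlip p (e.symm t) (by simpa using hmem) p' (e.symm t₀)
    (by simpa using hmem₀)
  refine ⟨e t', ht', ?_⟩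
  calc ‖e t' - t‖ = ‖(e : F' →L[ℝ] F) (t' - e.symm t)‖ := by simp
    _ ≤ ‖(e : F' →L[ℝ] F)‖ * L * ‖p' - p‖ := by
        rw [mul_assoc]
        exact (ContinuousLinearMap.le_opNorm _ _).trans (by gcongr)

lemma image_fst_image_fst_prodAssoc {G : Type*} (s : Set (E × F × G)) :
    Prod.fst '' (Prod.fst '' (Equiv.prodAssoc E F G ⁻¹' s)) = Prod.fst '' s := by
  rw [Set.image_image, ← (Equiv.prodAssoc E F G).image_symm_eq_preimage, Set.image_image]
  rfl

lemma image_fst_preimage_prodMap_id {F' : Type*} {e : F' → F} (he : e.Surjective)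
    (s : Set (E × F)) : Prod.fst '' (Prod.map id e ⁻¹' s) = Prod.fst '' s := by
  ext p
  simp [he.exists]

end Elimination

section Projection

lemma IsPolyhedron.image_fst_and_hasLipschitzFibres_pi (n : ℕ) :
    ∀ {E : Type*} [NormedAddCommGroup E] [NormedSpace ℝ E] [FiniteDimensional ℝ E]
      {s : Set (E × (Fin n → ℝ))}, IsPolyhedron s →
      IsPolyhedron (Prod.fst '' s) ∧ HasLipschitzFibres s := by
  induction n with
  | zero =>
    intro E _ _ _ s hs
    have himage : Prod.fst '' s = LinearMap.inl ℝ E (Fin 0 → ℝ) ⁻¹' s := by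
      ext p
      constructor
      · rintro ⟨⟨_, t⟩, h, rfl⟩
        rwa [Subsingleton.elim t 0] at h
      · exact fun h => ⟨_, h, rfl⟩
    refine ⟨himage ▸ hs.preimage (LinearMap.inl ℝ E (Fin 0 → ℝ)).toAffineMap, 0, le_rfl, ?_⟩
    intro p t _ p' t' ht'
    exact ⟨t', ht', by simp [Subsingleton.elim t' t]⟩
  | succ n ih =>
    intro E _ _ _ s hs
    let e : (ℝ × (Fin n → ℝ)) ≃L[ℝ] (Fin (n + 1) → ℝ) := Fin.consEquivL ℝ fun _ => ℝ
    have hcons : IsPolyhedron (Equiv.prodAssoc E ℝ (Fin n → ℝ) ⁻¹' (Prod.map id e ⁻¹' s)) :=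
      hs.preimage (LinearMap.id.prodMap e.toLinearMap ∘ₗ
        (LinearEquiv.prodAssoc ℝ E ℝ (Fin n → ℝ)).toLinearMap).toAffineMap
    obtain ⟨himage, hfibres⟩ := ih hcons
    refine ⟨?_, .of_linearEquiv e (.of_prodAssoc hfibres himage.hasLipschitzFibres_real)⟩
    rw [← image_fst_preimage_prodMap_id e.surjective, ← image_fst_image_fst_prodAssoc]
    exact himage.image_fst_real

variable {E F : Type*} [NormedAddCommGroup E] [NormedSpace ℝ E] [FiniteDimensional ℝ E]
  [NormedAddCommGroup F] [NormedSpace ℝ F] [FiniteDimensional ℝ F] {s : Set (E × F)}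

lemma IsPolyhedron.image_fst_and_hasLipschitzFibres (hs : IsPolyhedron s) :
    IsPolyhedron (Prod.fst '' s) ∧ HasLipschitzFibres s := by
  let e : (Fin (Module.finrank ℝ F) → ℝ) ≃L[ℝ] F := .ofFinrankEq (by simp)
  have hcoord : IsPolyhedron (Prod.map id e ⁻¹' s) :=
    hs.preimage ((LinearMap.id (R := ℝ) (M := E)).prodMap e.toLinearMap).toAffineMap
  obtain ⟨himage, hfibres⟩ := image_fst_and_hasLipschitzFibres_pi _ hcoord
  exact ⟨image_fst_preimage_prodMap_id e.surjective s ▸ himage, .of_linearEquiv e hfibres⟩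

end Projection

section Powers

lemma tendsto_pow_of_spectralRadius_lt_one {R : Type*} [NormedRing R] [NormedAlgebra ℂ R]
    [CompleteSpace R] {a : R} (ha : spectralRadius ℂ a < 1) :
    Tendsto (fun k : ℕ => a ^ k) atTop (𝓝 0) := by
  obtain ⟨r, har, hr⟩ := exists_between ha
  have hroot : ∀ᶠ k : ℕ in atTop, (‖a ^ k‖₊ : ENNReal) ^ (1 / k : ℝ) < r :=
    (spectrum.pow_nnnorm_pow_one_div_tendsto_nhds_spectralRadius a).eventually_lt_const har
  have hle : ∀ᶠ k : ℕ in atTop, (‖a ^ k‖₊ : ENNReal) ≤ r ^ k := by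
    filter_upwards [hroot, eventually_ne_atTop 0] with k hk hk0
    rw [← ENNReal.rpow_natCast r k, ← ENNReal.rpow_inv_le_iff (by positivity), ← one_div]
    exact hk.le
  have hzero : Tendsto (fun k : ℕ => (‖a ^ k‖₊ : ENNReal)) atTop (𝓝 0) :=
    tendsto_of_tendsto_of_tendsto_of_le_of_le' tendsto_const_nhds
      (ENNReal.tendsto_pow_atTop_nhds_zero_of_lt_one hr) (.of_forall fun _ => zero_le) hle
  rw [← ENNReal.coe_zero, ENNReal.tendsto_coe] at hzero
  exact tendsto_zero_iff_norm_tendsto_zero.2 (NNReal.tendsto_coe.2 hzero)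

attribute [local instance] Matrix.linftyOpNormedRing Matrix.linftyOpNormedAlgebra

variable {n : ℕ} {M : Matrix (Fin n) (Fin n) ℝ}

lemma IsSchur.tendsto_pow (hM : IsSchur M) : Tendsto (fun k : ℕ => M ^ k) atTop (𝓝 0) := by
  have hradius : spectralRadius ℂ (M.map (algebraMap ℝ ℂ)) < 1 := by
    rcases (spectrum ℂ (M.map (algebraMap ℝ ℂ))).eq_empty_or_nonempty with hempty | hne
    · rw [spectralRadius, hempty]
      simp
    · exact spectrum.spectralRadius_lt_of_forall_lt_of_nonempty hne (r := 1) hM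
  have : CompleteSpace (Matrix (Fin n) (Fin n) ℂ) := FiniteDimensional.complete ℂ _
  have hre := ((Continuous.matrix_map continuous_id Complex.continuous_re).tendsto 0).comp
    (tendsto_pow_of_spectralRadius_lt_one hradius)
  simp only [id_eq, Matrix.map_zero _ Complex.zero_re] at hre
  refine hre.congr fun k => ?_
  have hpow : M.map (algebraMap ℝ ℂ) ^ k = (M ^ k).map (algebraMap ℝ ℂ) :=
    (map_pow (algebraMap ℝ ℂ).mapMatrix M k).symm
  rw [Function.comp_apply, hpow]
  ext i j
  simp

lemma tendsto_pow_of_tendsto_pow_mulVec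
    (h : ∀ x, Tendsto (fun k : ℕ => (M ^ k) *ᵥ x) atTop (𝓝 0)) :
    Tendsto (fun k : ℕ => M ^ k) atTop (𝓝 0) := by
  refine tendsto_pi_nhds.2 fun i => tendsto_pi_nhds.2 fun j => ?_
  simpa using (tendsto_pi_nhds.1 (h (Pi.single j 1))) i

lemma eventually_norm_pow_mulVec_le (h : Tendsto (fun k : ℕ => M ^ k) atTop (𝓝 0)) {c : ℝ}
    (hc : 0 < c) : ∀ᶠ k : ℕ in atTop, ∀ x, ‖(M ^ k) *ᵥ x‖ ≤ c * ‖x‖ := by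
  filter_upwards [(tendsto_zero_iff_norm_tendsto_zero.1 h).eventually_le_const hc] with k hk x
  exact (Matrix.linfty_opNorm_mulVec _ _).trans (by gcongr)

lemma exists_norm_pow_mulVec_le (h : Tendsto (fun k : ℕ => M ^ k) atTop (𝓝 0)) :
    ∃ C, 0 ≤ C ∧ ∀ (k : ℕ) x, ‖(M ^ k) *ᵥ x‖ ≤ C * ‖x‖ := by
  obtain ⟨C, hC⟩ := h.norm.bddAbove_range
  have hle (k : ℕ) : ‖M ^ k‖ ≤ C := hC ⟨k, rfl⟩
  exact ⟨C, (norm_nonneg _).trans (hle 0), fun k x =>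
    (Matrix.linfty_opNorm_mulVec _ _).trans (by gcongr; exact hle k)⟩

end Powers

section Lyapunov

variable {n p : ℕ} {M : Matrix (Fin n) (Fin n) ℝ}

lemma norm_sq_le_wsq_one (x : Fin n → ℝ) : ‖x‖ ^ 2 ≤ wsq 1 x := by
  have hsq : wsq 1 x = ∑ i, x i ^ 2 := by simp [wsq, dotProduct, sq]
  have hnonneg : 0 ≤ wsq 1 x := hsq ▸ Finset.sum_nonneg fun i _ => sq_nonneg _
  rw [← Real.le_sqrt (norm_nonneg _) hnonneg, pi_norm_le_iff_of_nonneg (Real.sqrt_nonneg _)]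
  intro i
  rw [Real.le_sqrt (norm_nonneg _) hnonneg, Real.norm_eq_abs, sq_abs, hsq]
  exact Finset.single_le_sum (f := fun i => x i ^ 2) (fun i _ => sq_nonneg _) (Finset.mem_univ i)

lemma exists_lyapunovForm (hM : Tendsto (fun k : ℕ => M ^ k) atTop (𝓝 0)) :
    ∃ V : QuadraticForm ℝ (Fin n → ℝ), (∀ x, 0 ≤ V x) ∧ ∀ x, V (M *ᵥ x) + ‖x‖ ^ 2 ≤ V x := by
  obtain ⟨C, hC, hle⟩ := exists_quadraticForm_le (E := Fin n → ℝ)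
    (Matrix.toQuadraticForm' (1 : Matrix (Fin n) (Fin n) ℝ))
  simp only [toQuadraticForm'_eq_wsq] at hle
  obtain ⟨k, hk⟩ := (eventually_norm_pow_mulVec_le hM
    (c := √(1 / (2 * C))) (by positivity)).exists
  have hhalf (x : Fin n → ℝ) : 2 * wsq 1 (M ^ k *ᵥ x) ≤ wsq 1 x := by
    calc 2 * wsq 1 (M ^ k *ᵥ x) ≤ 2 * (C * (√(1 / (2 * C)) * ‖x‖) ^ 2) := by
          gcongr; exact (hle _).trans (by gcongr; exact hk x)
      _ = ‖x‖ ^ 2 := by rw [mul_pow, Real.sq_sqrt (by positivity)]; field_simp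
      _ ≤ wsq 1 x := norm_sq_le_wsq_one x
  let V : QuadraticForm ℝ (Fin n → ℝ) :=
    (2 : ℝ) • ∑ i ∈ Finset.range k, (Matrix.toQuadraticForm' 1).comp (M ^ i).mulVecLin
  have hV (x) : V x = 2 * ∑ i ∈ Finset.range k, wsq 1 (M ^ i *ᵥ x) := by
    simp only [V, smul_apply, sum_apply, QuadraticMap.comp_apply,
      Matrix.mulVecLin_apply, toQuadraticForm'_eq_wsq, smul_eq_mul]
  refine ⟨V, fun x => ?_, fun x => ?_⟩
  · rw [hV]
    exact mul_nonneg zero_le_two (Finset.sum_nonneg fun i _ => wsq_nonneg .one _)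
  · have htelescope := (Finset.sum_range_succ' (fun i => wsq 1 (M ^ i *ᵥ x)) k).symm.trans
      (Finset.sum_range_succ (fun i => wsq 1 (M ^ i *ᵥ x)) k)
    simp only [pow_succ, pow_zero, Matrix.one_mulVec, ← Matrix.mulVec_mulVec] at htelescope
    rw [hV, hV]
    linarith [hhalf x, norm_sq_le_wsq_one x]

lemma tendsto_zero_of_forall_add_le {f e : ℕ → ℝ} (hf : ∀ k, 0 ≤ f k) (he : ∀ k, 0 ≤ e k)
    (h : ∀ k, f (k + 1) + e k ≤ f k) : Tendsto e atTop (𝓝 0) := by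
  have hsum (k : ℕ) : ∑ i ∈ Finset.range k, e i + f k ≤ f 0 := by
    induction k with
    | zero => simp
    | succ k ih =>
      rw [Finset.sum_range_succ]
      linarith [h k]
  exact (summable_of_sum_range_le he fun k =>
    (le_add_of_nonneg_right (hf k)).trans (hsum k)).tendsto_atTop_zero

lemma tendsto_pow_of_lyapunov {V : (Fin n → ℝ) → ℝ} (hV : ∀ x, 0 ≤ V x)
    (hdec : ∀ x, V (M *ᵥ x) + ‖x‖ ^ 2 ≤ V x) : Tendsto (fun k : ℕ => M ^ k) atTop (𝓝 0) := by
  refine tendsto_pow_of_tendsto_pow_mulVec fun x => ?_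
  have hsq : Tendsto (fun k : ℕ => ‖M ^ k *ᵥ x‖ ^ 2) atTop (𝓝 0) :=
    tendsto_zero_of_forall_add_le (f := fun k => V (M ^ k *ᵥ x)) (fun k => hV _)
      (fun k => sq_nonneg _) fun k => by
        rw [pow_succ' M, ← Matrix.mulVec_mulVec]
        exact hdec _
  rw [tendsto_zero_iff_norm_tendsto_zero]
  simpa using hsq.sqrt

lemma exists_quadraticForm_le_mul_of_posDef {E : Type*} [NormedAddCommGroup E] [NormedSpace ℝ E]
    [FiniteDimensional ℝ E] (q : QuadraticForm ℝ E) {q' : QuadraticForm ℝ E} (hq' : q'.PosDef) :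
    ∃ C, 0 < C ∧ ∀ x, q x ≤ C * q' x := by
  obtain ⟨C, hC, hle⟩ := exists_quadraticForm_le q
  obtain ⟨c, hc, hge⟩ := exists_le_quadraticForm_of_posDef hq'
  refine ⟨C / c, by positivity, fun x => (hle x).trans ?_⟩
  rw [div_mul_eq_mul_div, le_div_iff₀ hc, mul_assoc, mul_comm _ c]
  gcongr
  exact hge x

lemma posDef_toQuadraticForm' {R : Matrix (Fin n) (Fin n) ℝ} (hR : R.PosDef) :
    R.toQuadraticForm'.PosDef := fun x hx => by
  rw [toQuadraticForm'_eq_wsq]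
  exact wsq_pos hR hx

lemma wsq_mulVec (M : Matrix (Fin n) (Fin n) ℝ) (T : Matrix (Fin n) (Fin p) ℝ) (y : Fin p → ℝ) :
    wsq M (T *ᵥ y) = wsq (Tᵀ * M * T) y := by
  rw [wsq, wsq, ← Matrix.mulVec_mulVec, ← Matrix.mulVec_mulVec, Matrix.dotProduct_mulVec y,
    Matrix.vecMul_transpose]

open scoped MatrixOrder Matrix.Norms.L2Operator in
lemma exists_eq_transpose_mul_self {Q : Matrix (Fin n) (Fin n) ℝ} (hQ : Q.PosSemidef) :
    ∃ T : Matrix (Fin n) (Fin n) ℝ, Q = Tᵀ * T := by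
  obtain ⟨T, hT⟩ := CStarAlgebra.nonneg_iff_eq_star_mul_self.mp hQ.nonneg
  exact ⟨T, by rw [hT, Matrix.star_eq_conjTranspose, Matrix.conjTranspose_eq_transpose_of_trivial]⟩

lemma exists_quadraticForm_mulVec_le_wsq (q : QuadraticForm ℝ (Fin p → ℝ))
    (L : Matrix (Fin p) (Fin n) ℝ) {Q : Matrix (Fin n) (Fin n) ℝ} (hQ : Q.PosSemidef) :
    ∃ C, 0 < C ∧ ∀ x, q ((L * Q) *ᵥ x) ≤ C * wsq Q x := by
  obtain ⟨T, rfl⟩ := exists_eq_transpose_mul_self hQ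
  obtain ⟨C, hC, hle⟩ := exists_quadraticForm_le_mul_of_posDef (q.comp (L * Tᵀ).mulVecLin)
    (posDef_toQuadraticForm' (.one (n := Fin n)))
  refine ⟨C, hC, fun x => ?_⟩
  have h := hle (T *ᵥ x)
  rwa [QuadraticMap.comp_apply, Matrix.mulVecLin_apply, Matrix.mulVec_mulVec, Matrix.mul_assoc,
    toQuadraticForm'_eq_wsq, wsq_mulVec, Matrix.mul_one] at h

/-- Along `A x + B w = (A - L Q) x + (L Q x + B w)`, a Lyapunov form of `A - L Q` becomes a
storage function for the stage cost. -/
lemma IsDetectable.exists_storageForm {A Q : Matrix (Fin n) (Fin n) ℝ} (hdet : IsDetectable A Q)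
    (hQ : Q.PosSemidef) (B : Matrix (Fin n) (Fin p) ℝ) {R : Matrix (Fin p) (Fin p) ℝ}
    (hR : R.PosDef) :
    ∃ (V : QuadraticForm ℝ (Fin n → ℝ)) (C : ℝ), 0 < C ∧ (∀ x, 0 ≤ V x) ∧
      ∀ x w, V (A *ᵥ x + B *ᵥ w) + ‖x‖ ^ 2 ≤ V x + C * (wsq Q x + wsq R w) := by
  obtain ⟨L, hL⟩ := hdet
  obtain ⟨V, hV, hdec⟩ := exists_lyapunovForm hL.tendsto_pow
  obtain ⟨c, hc, hVle⟩ := exists_quadraticForm_le V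
  obtain ⟨cQ, hcQ, hVQ⟩ := exists_quadraticForm_mulVec_le_wsq V L hQ
  obtain ⟨cR, hcR, hVR⟩ := exists_quadraticForm_le_mul_of_posDef (V.comp B.mulVecLin)
    (posDef_toQuadraticForm' hR)
  simp only [QuadraticMap.comp_apply, Matrix.mulVecLin_apply, toQuadraticForm'_eq_wsq] at hVR
  have hcomplement (x w) : V ((L * Q) *ᵥ x + B *ᵥ w) ≤ 2 * (cQ + cR) * (wsq Q x + wsq R w) := by
    have hcross := add_nonneg (mul_nonneg hcR.le (wsq_nonneg hQ x))
      (mul_nonneg hcQ.le (wsq_nonneg hR.posSemidef w))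
    linarith [quadraticForm_add_le_two hV ((L * Q) *ᵥ x) (B *ᵥ w), hVQ x, hVR w]
  have hyoung (x w) : V (A *ᵥ x + B *ᵥ w) ≤ (1 + (2 * c)⁻¹) * V ((A - L * Q) *ᵥ x)
      + (1 + 2 * c) * V ((L * Q) *ᵥ x + B *ᵥ w) := by
    have h := quadraticForm_add_le hV (η := (2 * c)⁻¹) (by positivity) ((A - L * Q) *ᵥ x)
      ((L * Q) *ᵥ x + B *ᵥ w)
    rwa [inv_inv, ← add_assoc, ← Matrix.add_mulVec, sub_add_cancel] at h
  have hcontract (x) : (1 + (2 * c)⁻¹) * V ((A - L * Q) *ᵥ x) ≤ V x - ‖x‖ ^ 2 / 2 := by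
    have hc' : (2 * c)⁻¹ * V x ≤ ‖x‖ ^ 2 / 2 := by
      rw [inv_mul_le_iff₀ (by positivity)]
      linarith [hVle x]
    have hpos : 0 ≤ (2 * c)⁻¹ * ‖x‖ ^ 2 := by positivity
    have hscaled := mul_le_mul_of_nonneg_left (hdec x) (show 0 ≤ 1 + (2 * c)⁻¹ by positivity)
    linarith
  refine ⟨(2 : ℝ) • V, 4 * (1 + 2 * c) * (cQ + cR), by positivity, fun x => ?_, fun x w => ?_⟩
  · exact mul_nonneg zero_le_two (hV x)
  · rw [smul_apply, smul_apply, smul_eq_mul, smul_eq_mul]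
    have hscaled := mul_le_mul_of_nonneg_left (hcomplement x w) (show 0 ≤ 1 + 2 * c by positivity)
    linarith [hyoung x w, hcontract x]

lemma IsDetectable.exists_storageForm_add {A Q : Matrix (Fin n) (Fin n) ℝ}
    (hdet : IsDetectable A Q) (hQ : Q.PosSemidef) (B : Matrix (Fin n) (Fin p) ℝ)
    {R : Matrix (Fin p) (Fin p) ℝ} (hR : R.PosDef) {d : ℕ} (T : Matrix (Fin n) (Fin d) ℝ) :
    ∃ (V : QuadraticForm ℝ (Fin n → ℝ)) (C c : ℝ), 0 < C ∧ 0 < c ∧ (∀ x, 0 ≤ V x) ∧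
      ∀ x w y, V (A *ᵥ x + B *ᵥ w + T *ᵥ y) + ‖x‖ ^ 2 / 2
        ≤ V x + C * (wsq Q x + wsq R w) + c * ‖y‖ ^ 2 := by
  obtain ⟨V, C, hC, hV, hdec⟩ := hdet.exists_storageForm hQ B hR
  obtain ⟨b, hb, hVle⟩ := exists_quadraticForm_le V
  obtain ⟨bT, hbT, hVT⟩ := exists_quadraticForm_le (V.comp T.mulVecLin)
  refine ⟨V, (1 + (2 * b)⁻¹) * C, (1 + 2 * b) * bT, by positivity, by positivity, hV,
    fun x w y => ?_⟩
  have hyoung := quadraticForm_add_le hV (η := (2 * b)⁻¹) (by positivity) (A *ᵥ x + B *ᵥ w)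
    (T *ᵥ y)
  rw [inv_inv] at hyoung
  have hscaled := mul_le_mul_of_nonneg_left (hdec x w) (show 0 ≤ 1 + (2 * b)⁻¹ by positivity)
  have hperturbation := mul_le_mul_of_nonneg_left (hVT y) (show 0 ≤ 1 + 2 * b by positivity)
  rw [QuadraticMap.comp_apply, Matrix.mulVecLin_apply] at hperturbation
  have hsmall : (2 * b)⁻¹ * V x ≤ ‖x‖ ^ 2 / 2 := by
    rw [inv_mul_le_iff₀ (by positivity)]
    linarith [hVle x]
  have hpos : 0 ≤ (2 * b)⁻¹ * ‖x‖ ^ 2 := by positivity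
  linarith

end Lyapunov

section LQR

lemma riccati_closedLoop {n p : Type*} [Fintype n] [Fintype p] {A P Q : Matrix n n ℝ}
    {B : Matrix n p ℝ} {R : Matrix p p ℝ} {K : Matrix p n ℝ}
    (hK : (R + Bᵀ * P * B) * K = Bᵀ * P * A) (hP : P = Q + Aᵀ * P * A - Aᵀ * P * B * K) :
    (A - B * K)ᵀ * P * (A - B * K) + (Q + Kᵀ * R * K) = P := by
  have hgain : Kᵀ * ((R + Bᵀ * P * B) * K) = Kᵀ * (Bᵀ * P * A) := by rw [hK]
  conv_rhs => rw [hP]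
  simp only [Matrix.transpose_sub, Matrix.transpose_mul, Matrix.sub_mul, Matrix.mul_sub,
    Matrix.add_mul, Matrix.mul_add, Matrix.mul_assoc] at hgain ⊢
  rw [← hgain]
  abel

namespace Setup

variable {nx nu ny nz m : ℕ} (S : Setup nx nu ny nz m)

/-- The closed-loop matrix `A - B K`, which propagates the tracking error of the LQR loop. -/
def Acl : Matrix (Fin nx) (Fin nx) ℝ := S.A - S.B * S.K

variable {S}

lemma Acl_mulVec (x : Fin nx → ℝ) : S.Acl *ᵥ x = S.A *ᵥ x + S.B *ᵥ (-(S.K *ᵥ x)) := by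
  rw [Acl, Matrix.sub_mulVec, Matrix.mulVec_neg, Matrix.mulVec_mulVec, sub_eq_add_neg]

lemma wsq_Acl_add_stageCost (hR : S.R.PosDef) (hP : S.P.PosSemidef) (hDARE : S.SolvesDARE)
    (x : Fin nx → ℝ) :
    wsq S.P (S.Acl *ᵥ x) + (wsq S.Q x + wsq S.R (-(S.K *ᵥ x))) = wsq S.P x := by
  have hinv : IsUnit (S.R + S.Bᵀ * S.P * S.B).det :=
    (hR.add_posSemidef (by simpa using hP.conjTranspose_mul_mul_same S.B)).det_pos.ne'.isUnit
  have hK : (S.R + S.Bᵀ * S.P * S.B) * S.K = S.Bᵀ * S.P * S.A := by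
    rw [K, ← Matrix.mul_assoc, Matrix.mul_nonsing_inv _ hinv, Matrix.one_mul]
  have hriccati : S.P = S.Q + S.Aᵀ * S.P * S.A - S.Aᵀ * S.P * S.B * S.K := by
    rw [K, ← Matrix.mul_assoc (S.Aᵀ * S.P * S.B)]
    exact hDARE
  rw [← Matrix.neg_mulVec, wsq_mulVec, wsq_mulVec, wsq, wsq, wsq, wsq, ← dotProduct_add,
    ← dotProduct_add, ← Matrix.add_mulVec, ← Matrix.add_mulVec, Matrix.transpose_neg,
    Matrix.mul_neg, Matrix.neg_mul, Matrix.neg_mul, neg_neg, Acl, riccati_closedLoop hK hriccati]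

lemma tendsto_Acl_pow (hQ : S.Q.PosSemidef) (hdet : IsDetectable S.A S.Q) (hR : S.R.PosDef)
    (hP : S.P.PosSemidef) (hDARE : S.SolvesDARE) :
    Tendsto (fun k : ℕ => S.Acl ^ k) atTop (𝓝 0) := by
  obtain ⟨V, C, hC, hV, hstorage⟩ := hdet.exists_storageForm hQ S.B hR
  refine tendsto_pow_of_lyapunov (V := fun x => C * wsq S.P x + V x)
    (fun x => add_nonneg (mul_nonneg hC.le (wsq_nonneg hP x)) (hV x)) fun x => ?_
  have hcost := wsq_Acl_add_stageCost hR hP hDARE x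
  have hstep := hstorage x (-(S.K *ᵥ x))
  rw [← Acl_mulVec] at hstep
  rw [← hcost]
  linarith

end Setup

end LQR

section Observability

variable {n p : ℕ} (H : Matrix (Fin p) (Fin n) ℝ) (M : Matrix (Fin n) (Fin n) ℝ)

lemma exists_mulVec_pow_eq_zero_of_forall_lt :
    ∃ J : ℕ, ∀ x, (∀ j < J, H *ᵥ (M ^ j *ᵥ x) = 0) → ∀ j, H *ᵥ (M ^ j *ᵥ x) = 0 := by
  let U (J : ℕ) : Submodule ℝ (Fin n → ℝ) :=
    ⨅ j : Fin J, LinearMap.ker (H * M ^ (j : ℕ)).mulVecLin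
  have hU (J : ℕ) (x : Fin n → ℝ) : x ∈ U J ↔ ∀ j < J, H *ᵥ (M ^ j *ᵥ x) = 0 := by
    simp [U, Submodule.mem_iInf, Fin.forall_iff]
  have hanti : Antitone U := fun J J' hJ x hx => by
    rw [hU] at hx ⊢
    exact fun j hj => hx j (hj.trans_le hJ)
  obtain ⟨J, hJ⟩ := IsArtinian.monotone_stabilizes
    (⟨fun J => OrderDual.toDual (U J), hanti.dual_right⟩ : ℕ →o (Submodule ℝ (Fin n → ℝ))ᵒᵈ)
  refine ⟨J, fun x hx j => ?_⟩
  have hmem : x ∈ U (J + j + 1) := by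
    rw [← show U J = U (J + j + 1) from hJ _ (by omega)]
    exact (hU J x).2 hx
  exact (hU _ x).1 hmem j (by omega)

lemma exists_norm_le_of_map_eq {E F : Type*} [NormedAddCommGroup E] [NormedSpace ℝ E]
    [FiniteDimensional ℝ E] [NormedAddCommGroup F] [NormedSpace ℝ F] (l : E →ₗ[ℝ] F) :
    ∃ C, 0 < C ∧ ∀ x, ∃ y, l y = l x ∧ ‖y‖ ≤ C * ‖l x‖ := by
  obtain ⟨C, hC, hpre⟩ := (LinearMap.toContinuousLinearMap l.rangeRestrict).exists_preimage_norm_le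
    l.surjective_rangeRestrict
  refine ⟨C, hC, fun x => ?_⟩
  obtain ⟨y, hy, hle⟩ := hpre (l.rangeRestrict x)
  exact ⟨y, congrArg Subtype.val hy, hle⟩

/-- A state with small observations agrees with a small state up to an unobservable one. -/
lemma exists_norm_mulVec_pow_le_of_forall_lt {M : Matrix (Fin n) (Fin n) ℝ}
    (hM : Tendsto (fun k : ℕ => M ^ k) atTop (𝓝 0)) (b : ℝ) {δ : ℝ} (hδ : 0 < δ) :
    ∃ J : ℕ, ∀ x, (∀ j < J, ‖H *ᵥ (M ^ j *ᵥ x)‖ ≤ b) → ∀ j ≥ J, ‖H *ᵥ (M ^ j *ᵥ x)‖ ≤ δ := by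
  obtain ⟨J₀, hker⟩ := exists_mulVec_pow_eq_zero_of_forall_lt H M
  let O : (Fin n → ℝ) →ₗ[ℝ] (Fin J₀ → Fin p → ℝ) :=
    LinearMap.pi fun j => (H * M ^ (j : ℕ)).mulVecLin
  have hO (x) (j : Fin J₀) : O x j = H *ᵥ (M ^ (j : ℕ) *ᵥ x) := by simp [O]
  obtain ⟨C, hC, hpre⟩ := exists_norm_le_of_map_eq O
  obtain ⟨c, hc, hH⟩ := (LinearMap.toContinuousLinearMap H.mulVecLin).bound
  obtain ⟨J₁, hJ₁⟩ := eventually_atTop.1 (eventually_norm_pow_mulVec_le hM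
    (c := δ / (c * (C * max b 1))) (by positivity))
  refine ⟨max J₀ J₁, fun x hx j hj => ?_⟩
  obtain ⟨y, hyx, hy⟩ := hpre x
  have hOx : ‖O x‖ ≤ max b 1 := (pi_norm_le_iff_of_nonneg (by positivity)).2 fun i =>
    (hO x i ▸ hx i (i.2.trans_le (le_max_left _ _))).trans (le_max_left _ _)
  have hunobservable : H *ᵥ (M ^ j *ᵥ (x - y)) = 0 := hker _ (fun i hi => by
    rw [← hO _ ⟨i, hi⟩, map_sub, hyx, sub_self, Pi.zero_apply]) j
  rw [Matrix.mulVec_sub, Matrix.mulVec_sub, sub_eq_zero] at hunobservable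
  calc ‖H *ᵥ (M ^ j *ᵥ x)‖ = ‖H *ᵥ (M ^ j *ᵥ y)‖ := by rw [hunobservable]
    _ ≤ c * ‖M ^ j *ᵥ y‖ := hH _
    _ ≤ c * (δ / (c * (C * max b 1)) * (C * max b 1)) := by
      gcongr
      refine (hJ₁ j ((le_max_right _ _).trans hj) y).trans ?_
      gcongr
      exact hy.trans (by gcongr)
    _ = δ := by field_simp

end Observability

namespace Setup

variable {nx nu ny nz m : ℕ} {S : Setup nx nu ny nz m} {N : ℕ}

section Equilibria

lemma mulVec_xbar_add_mulVec_ubar (hG : S.IsEquilibriumBasis) (v : Fin nz → ℝ) :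
    S.A *ᵥ S.xbar v + S.B *ᵥ S.ubar v = S.xbar v := by
  have hker (j) : S.Z *ᵥ (fun i => S.G i j) = 0 :=
    LinearMap.mem_ker.1 (hG.2.le (Submodule.subset_span ⟨j, rfl⟩))
  have hZG : S.Z * S.G = 0 := by
    ext i j
    exact congrFun (hker j) i
  have hblock : (S.A - 1) * S.Gx + S.B * S.Gu = 0 := by
    simpa only [Z, G, Matrix.fromRows_mul, Matrix.toRows₁_fromRows, Matrix.fromCols_mul_fromRows,
      Matrix.zero_mul, add_zero] using
        show (S.Z * S.G).toRows₁ = 0 from congrArg Matrix.toRows₁ hZG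
  have h := congrArg (· *ᵥ v) hblock
  simp only [Matrix.add_mulVec, ← Matrix.mulVec_mulVec, Matrix.sub_mulVec, Matrix.one_mulVec,
    Matrix.zero_mulVec] at h
  rw [xbar, ubar, ← sub_eq_zero, ← h, sub_add_eq_add_sub]

lemma mulVec_add_mulVec_sub_xbar {v : Fin nz → ℝ}
    (heq : S.A *ᵥ S.xbar v + S.B *ᵥ S.ubar v = S.xbar v) (x : Fin nx → ℝ) (u : Fin nu → ℝ) :
    S.A *ᵥ x + S.B *ᵥ u - S.xbar v = S.A *ᵥ (x - S.xbar v) + S.B *ᵥ (u - S.ubar v) := by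
  conv_lhs => rw [← heq]
  rw [Matrix.mulVec_sub, Matrix.mulVec_sub, add_sub_add_comm]

lemma lqrInput_sub_ubar (x : Fin nx → ℝ) (v : Fin nz → ℝ) :
    S.lqrInput v x - S.ubar v = -(S.K *ᵥ (x - S.xbar v)) := by
  rw [lqrInput, sub_sub_cancel_left]

lemma lqrState_sub_xbar {v : Fin nz → ℝ} (heq : S.A *ᵥ S.xbar v + S.B *ᵥ S.ubar v = S.xbar v)
    (x : Fin nx → ℝ) (j : ℕ) :
    S.lqrState x v j - S.xbar v = S.Acl ^ j *ᵥ (x - S.xbar v) := by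
  induction j with
  | zero => rw [lqrState, pow_zero, Matrix.one_mulVec]
  | succ j ih =>
    rw [lqrState, mulVec_add_mulVec_sub_xbar heq, lqrInput_sub_ubar, ← Acl_mulVec, ih, pow_succ',
      Matrix.mulVec_mulVec]

lemma lqrState_add (x : Fin nx → ℝ) (v : Fin nz → ℝ) (i j : ℕ) :
    S.lqrState (S.lqrState x v i) v j = S.lqrState x v (i + j) := by
  induction j with
  | zero => rfl
  | succ j ih => rw [← add_assoc, lqrState, ih, lqrState]

lemma lqr_output_eq (x : Fin nx → ℝ) (v : Fin nz → ℝ) :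
    S.C *ᵥ x + S.D *ᵥ S.lqrInput v x
      = (S.C - S.D * S.K) *ᵥ (x - S.xbar v) + (S.C * S.Gx + S.D * S.Gu) *ᵥ v := by
  rw [lqrInput, Matrix.add_mulVec, ← Matrix.mulVec_mulVec, ← Matrix.mulVec_mulVec, ← xbar, ← ubar,
    Matrix.sub_mulVec, ← Matrix.mulVec_mulVec, Matrix.mulVec_sub S.C, Matrix.mulVec_sub S.D]
  abel

end Equilibria

section Constraints

lemma isPolyhedron_constraintSet : IsPolyhedron S.constraintSet := by
  refine ⟨Set.range fun i => ((LinearMap.proj i).comp S.Y.mulVecLin).toAffineMap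
    - AffineMap.const ℝ _ (S.h i), Set.finite_range _, ?_⟩
  ext y
  simp [constraintSet, Pi.le_def]

lemma isPolyhedron_admissibleRefs (hε : S.ε < 1) : IsPolyhedron S.admissibleRefs := by
  have hpre : S.admissibleRefs
      = ((1 - S.ε)⁻¹ • (S.C * S.Gx + S.D * S.Gu).mulVecLin).toAffineMap ⁻¹' S.constraintSet := by
    ext v
    exact Set.mem_smul_set_iff_inv_smul_mem₀ (sub_pos.2 hε).ne' _ _
  exact hpre ▸ isPolyhedron_constraintSet.preimage _

lemma zero_mem_admissibleRefs (hY : (0 : Fin ny → ℝ) ∈ S.constraintSet) :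
    0 ∈ S.admissibleRefs :=
  ⟨0, hY, by simp⟩

lemma exists_margin (hε : S.ε ∈ Set.Ioo (0 : ℝ) 1)
    (hYzero : (0 : Fin ny → ℝ) ∈ interior S.constraintSet) :
    ∃ δ, 0 < δ ∧ ∀ v ∈ S.admissibleRefs, ∀ y : Fin ny → ℝ, ‖y‖ ≤ δ →
      y + (S.C * S.Gx + S.D * S.Gu) *ᵥ v ∈ S.constraintSet := by
  obtain ⟨δ, hδ, hball⟩ :=
    Metric.nhds_basis_closedBall.mem_iff.1 (mem_interior_iff_mem_nhds.1 hYzero)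
  refine ⟨S.ε * δ, mul_pos hε.1 hδ, ?_⟩
  rintro v ⟨w, hw, hwv⟩ y hy
  have hmem : S.ε⁻¹ • y ∈ S.constraintSet := hball <| by
    rw [mem_closedBall_zero_iff, norm_smul, norm_inv, Real.norm_of_nonneg hε.1.le,
      inv_mul_le_iff₀ hε.1]
    exact hy
  have hcombination := isPolyhedron_constraintSet.convex hmem hw hε.1.le
    (sub_nonneg.2 hε.2.le) (add_sub_cancel _ _)
  rw [smul_inv_smul₀ hε.1.ne'] at hcombination
  exact hwv ▸ hcombination

end Constraints

section TerminalSet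

lemma mem_terminalSet_iff (heq : ∀ v, S.A *ᵥ S.xbar v + S.B *ᵥ S.ubar v = S.xbar v)
    {x : Fin nx → ℝ} {v : Fin nz → ℝ} :
    (x, v) ∈ S.terminalSet ↔ v ∈ S.admissibleRefs ∧
      ∀ j : ℕ, (S.C - S.D * S.K) *ᵥ (S.Acl ^ j *ᵥ (x - S.xbar v))
        + (S.C * S.Gx + S.D * S.Gu) *ᵥ v ∈ S.constraintSet := by
  have hsteady : S.C *ᵥ S.xbar v + S.D *ᵥ S.ubar v = (S.C * S.Gx + S.D * S.Gu) *ᵥ v := by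
    rw [xbar, ubar, Matrix.mulVec_mulVec, Matrix.mulVec_mulVec, Matrix.add_mulVec]
  simp only [terminalSet, Set.mem_ofPred_eq, lqr_output_eq, lqrState_sub_xbar (heq v), hsteady,
    admissibleRefs]

lemma exists_forall_mem_terminalSet
    (heq : ∀ v, S.A *ᵥ S.xbar v + S.B *ᵥ S.ubar v = S.xbar v)
    (hAcl : Tendsto (fun k : ℕ => S.Acl ^ k) atTop (𝓝 0)) (hε : S.ε ∈ Set.Ioo (0 : ℝ) 1)
    (hYzero : (0 : Fin ny → ℝ) ∈ interior S.constraintSet) :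
    ∃ r, 0 < r ∧ ∀ v ∈ S.admissibleRefs, ∀ x, ‖x - S.xbar v‖ ≤ r → (x, v) ∈ S.terminalSet := by
  obtain ⟨δ, hδ, hmargin⟩ := exists_margin hε hYzero
  obtain ⟨C, hC, hpow⟩ := exists_norm_pow_mulVec_le hAcl
  obtain ⟨c, hc, hout⟩ := (LinearMap.toContinuousLinearMap (S.C - S.D * S.K).mulVecLin).bound
  refine ⟨δ / (c * (C + 1)), by positivity, fun v hv x hx =>
    (mem_terminalSet_iff heq).2 ⟨hv, fun j => hmargin v hv _ ?_⟩⟩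
  calc ‖(S.C - S.D * S.K) *ᵥ (S.Acl ^ j *ᵥ (x - S.xbar v))‖
      ≤ c * ‖S.Acl ^ j *ᵥ (x - S.xbar v)‖ := hout _
    _ ≤ c * ((C + 1) * (δ / (c * (C + 1)))) := by
      gcongr
      exact (hpow j _).trans (by gcongr; linarith)
    _ = δ := by field_simp

lemma exists_mem_terminalSet_iff_forall_lt
    (heq : ∀ v, S.A *ᵥ S.xbar v + S.B *ᵥ S.ubar v = S.xbar v)
    (hAcl : Tendsto (fun k : ℕ => S.Acl ^ k) atTop (𝓝 0)) (hε : S.ε ∈ Set.Ioo (0 : ℝ) 1)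
    (hYcompact : IsCompact S.constraintSet)
    (hYzero : (0 : Fin ny → ℝ) ∈ interior S.constraintSet) :
    ∃ J : ℕ, ∀ x v, (x, v) ∈ S.terminalSet ↔ v ∈ S.admissibleRefs ∧
      ∀ j < J, (S.C - S.D * S.K) *ᵥ (S.Acl ^ j *ᵥ (x - S.xbar v))
        + (S.C * S.Gx + S.D * S.Gu) *ᵥ v ∈ S.constraintSet := by
  obtain ⟨δ, hδ, hmargin⟩ := exists_margin hε hYzero
  obtain ⟨b, hb⟩ := hYcompact.isBounded.exists_norm_le
  obtain ⟨J, hJ⟩ := exists_norm_mulVec_pow_le_of_forall_lt (S.C - S.D * S.K) hAcl (b + b) hδ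
  refine ⟨J, fun x v => (mem_terminalSet_iff heq).trans (and_congr_right fun hv =>
    ⟨fun h j _ => h j, fun h j => ?_⟩)⟩
  rcases lt_or_ge j J with hj | hj
  · exact h j hj
  refine hmargin v hv _ (hJ _ (fun i hi => ?_) j hj)
  have hsteady : (S.C * S.Gx + S.D * S.Gu) *ᵥ v ∈ S.constraintSet := by
    simpa using hmargin v hv 0 (by simpa using hδ.le)
  simpa only [add_sub_cancel_right] using
    (norm_sub_le _ _).trans (add_le_add (hb _ (h i hi)) (hb _ hsteady))

lemma isPolyhedron_terminalSet (heq : ∀ v, S.A *ᵥ S.xbar v + S.B *ᵥ S.ubar v = S.xbar v)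
    (hAcl : Tendsto (fun k : ℕ => S.Acl ^ k) atTop (𝓝 0)) (hε : S.ε ∈ Set.Ioo (0 : ℝ) 1)
    (hYcompact : IsCompact S.constraintSet)
    (hYzero : (0 : Fin ny → ℝ) ∈ interior S.constraintSet) : IsPolyhedron S.terminalSet := by
  obtain ⟨J, hJ⟩ := exists_mem_terminalSet_iff_forall_lt heq hAcl hε hYcompact hYzero
  let out (j : ℕ) : (Fin nx → ℝ) × (Fin nz → ℝ) →ₗ[ℝ] (Fin ny → ℝ) :=
    ((S.C - S.D * S.K) * S.Acl ^ j).mulVecLin ∘ₗ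
        (LinearMap.fst ℝ _ _ - S.Gx.mulVecLin ∘ₗ LinearMap.snd ℝ _ _)
      + (S.C * S.Gx + S.D * S.Gu).mulVecLin ∘ₗ LinearMap.snd ℝ _ _
  have hout (j x v) : out j (x, v) = (S.C - S.D * S.K) *ᵥ (S.Acl ^ j *ᵥ (x - S.xbar v))
      + (S.C * S.Gx + S.D * S.Gu) *ᵥ v := by
    simp only [out, LinearMap.add_apply, LinearMap.comp_apply, LinearMap.sub_apply,
      Matrix.mulVecLin_apply, LinearMap.fst_apply, LinearMap.snd_apply, Matrix.mulVec_mulVec, xbar]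
  have hT : S.terminalSet = (LinearMap.snd ℝ _ _).toAffineMap ⁻¹' S.admissibleRefs
      ∩ ⋂ j : Fin J, (out j).toAffineMap ⁻¹' S.constraintSet := by
    ext ⟨x, v⟩
    simp only [hJ, Set.mem_inter_iff, Set.mem_preimage, Set.mem_iInter, LinearMap.coe_toAffineMap,
      hout, LinearMap.snd_apply, Fin.forall_iff]
  exact hT ▸ ((isPolyhedron_admissibleRefs hε.2).preimage _).inter
    (.iInter fun j => isPolyhedron_constraintSet.preimage _)

end TerminalSet

section Prediction

lemma predState_zero (x : Fin nx → ℝ) (μ : Fin N → Fin nu → ℝ) : S.predState x μ 0 = x := rfl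

lemma predState_succ (x : Fin nx → ℝ) (μ : Fin N → Fin nu → ℝ) (i : Fin N) :
    S.predState x μ i.succ = S.A *ᵥ S.predState x μ i.castSucc + S.B *ᵥ μ i :=
  Fin.induction_succ ..

lemma predState_lqr (x : Fin nx → ℝ) (v : Fin nz → ℝ) (i : Fin (N + 1)) :
    S.predState x (fun i : Fin N => S.lqrInput v (S.lqrState x v i)) i = S.lqrState x v i := by
  induction i using Fin.induction with
  | zero => rfl
  | succ i ih => rw [predState_succ, ih]; rfl

lemma predState_tail (x : Fin nx → ℝ) (μ : Fin (N + 1) → Fin nu → ℝ) (i : Fin (N + 1)) :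
    S.predState (S.A *ᵥ x + S.B *ᵥ μ 0) (Fin.tail μ) i = S.predState x μ i.succ := by
  induction i using Fin.induction with
  | zero => rfl
  | succ i ih => rw [predState_succ, predState_succ, ← Fin.succ_castSucc, ih, Fin.tail]

lemma predState_snoc (x : Fin nx → ℝ) (μ : Fin N → Fin nu → ℝ) (u : Fin nu → ℝ)
    (i : Fin (N + 1)) :
    S.predState x (Fin.snoc μ u : Fin (N + 1) → Fin nu → ℝ) i.castSucc = S.predState x μ i := by
  induction i using Fin.induction with
  | zero => rfl
  | succ i ih =>
    rw [← Fin.succ_castSucc, predState_succ, predState_succ, ih, Fin.snoc_castSucc]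

variable (S) in
/-- The predicted state `ξ_i` as a linear function of the triple `((x, v), μ)`. -/
def predStateLin (i : Fin (N + 1)) :
    ((Fin nx → ℝ) × (Fin nz → ℝ)) × (Fin N → Fin nu → ℝ) →ₗ[ℝ] (Fin nx → ℝ) :=
  Fin.induction (LinearMap.fst ℝ _ _ ∘ₗ LinearMap.fst ℝ _ _)
    (fun i l => S.A.mulVecLin ∘ₗ l + S.B.mulVecLin ∘ₗ LinearMap.proj i ∘ₗ LinearMap.snd ℝ _ _) i

lemma predStateLin_apply (i : Fin (N + 1))
    (p : ((Fin nx → ℝ) × (Fin nz → ℝ)) × (Fin N → Fin nu → ℝ)) :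
    S.predStateLin i p = S.predState p.1.1 p.2 i := by
  induction i using Fin.induction with
  | zero => rfl
  | succ i ih => rw [predState_succ, ← ih]; rfl

end Prediction

section FeasibleSet

variable (S N) in
/-- The graph of `(x, v) ↦ ocpFeasible N x v`; its projection to `(x, v)` is `Gam N`. -/
def ocpGraph : Set (((Fin nx → ℝ) × (Fin nz → ℝ)) × (Fin N → Fin nu → ℝ)) :=
  {p | p.2 ∈ S.ocpFeasible N p.1.1 p.1.2}

lemma image_fst_ocpGraph : Prod.fst '' S.ocpGraph N = S.Gam N := by
  ext p
  simp only [Set.mem_image, Prod.exists, exists_and_right, exists_eq_right]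
  rfl

lemma isPolyhedron_ocpGraph (hT : IsPolyhedron S.terminalSet) : IsPolyhedron (S.ocpGraph N) := by
  let out (i : Fin N) : ((Fin nx → ℝ) × (Fin nz → ℝ)) × (Fin N → Fin nu → ℝ) →ₗ[ℝ] (Fin ny → ℝ) :=
    S.C.mulVecLin ∘ₗ S.predStateLin i.castSucc
      + S.D.mulVecLin ∘ₗ LinearMap.proj i ∘ₗ LinearMap.snd ℝ _ _
  let terminal : ((Fin nx → ℝ) × (Fin nz → ℝ)) × (Fin N → Fin nu → ℝ) →ₗ[ℝ]
      (Fin nx → ℝ) × (Fin nz → ℝ) :=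
    (S.predStateLin (Fin.last N)).prod (LinearMap.snd ℝ _ _ ∘ₗ LinearMap.fst ℝ _ _)
  have hgraph : S.ocpGraph N = (⋂ i, (out i).toAffineMap ⁻¹' S.constraintSet)
      ∩ terminal.toAffineMap ⁻¹' S.terminalSet := by
    ext p
    simp only [ocpGraph, ocpFeasible, Set.mem_ofPred_eq, Set.mem_inter_iff, Set.mem_iInter,
      Set.mem_preimage, LinearMap.coe_toAffineMap, out, terminal, LinearMap.add_apply,
      LinearMap.comp_apply, Matrix.mulVecLin_apply, LinearMap.prod_apply, Function.prod,
      predStateLin_apply, LinearMap.proj_apply, LinearMap.fst_apply, LinearMap.snd_apply]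
  exact hgraph ▸ (IsPolyhedron.iInter fun i => isPolyhedron_constraintSet.preimage _).inter
    (hT.preimage _)

lemma isPolyhedron_Gam (hT : IsPolyhedron S.terminalSet) : IsPolyhedron (S.Gam N) :=
  image_fst_ocpGraph (S := S) ▸ (isPolyhedron_ocpGraph hT).image_fst_and_hasLipschitzFibres.1

lemma lqr_mem_ocpFeasible {x : Fin nx → ℝ} {v : Fin nz → ℝ} (h : (x, v) ∈ S.terminalSet) :
    (fun i : Fin N => S.lqrInput v (S.lqrState x v i)) ∈ S.ocpFeasible N x v := by
  refine ⟨fun i => ?_, ?_⟩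
  · rw [predState_lqr]
    exact h.2 i
  · rw [predState_lqr]
    refine ⟨h.1, fun j => ?_⟩
    rw [lqrState_add]
    exact h.2 _

lemma terminalSet_subset_Gam : S.terminalSet ⊆ S.Gam N :=
  fun _ h => ⟨_, lqr_mem_ocpFeasible h⟩

end FeasibleSet

section OptimalControl

variable (S N) in
/-- The cost of the optimal control problem as a quadratic form in the triple `((x, v), μ)`. -/
def ocpForm : QuadraticForm ℝ (((Fin nx → ℝ) × (Fin nz → ℝ)) × (Fin N → Fin nu → ℝ)) :=
  let v := LinearMap.snd ℝ (Fin nx → ℝ) (Fin nz → ℝ) ∘ₗ LinearMap.fst ℝ _ (Fin N → Fin nu → ℝ)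
  S.P.toQuadraticForm'.comp (S.predStateLin (Fin.last N) - S.Gx.mulVecLin ∘ₗ v)
    + ∑ i : Fin N, (S.Q.toQuadraticForm'.comp (S.predStateLin i.castSucc - S.Gx.mulVecLin ∘ₗ v)
      + S.R.toQuadraticForm'.comp
        (LinearMap.proj i ∘ₗ LinearMap.snd ℝ _ _ - S.Gu.mulVecLin ∘ₗ v))

lemma ocpForm_apply (p : ((Fin nx → ℝ) × (Fin nz → ℝ)) × (Fin N → Fin nu → ℝ)) :
    S.ocpForm N p = S.ocpCost p.1.1 p.1.2 p.2 := by
  simp only [ocpForm, add_apply, sum_apply, QuadraticMap.comp_apply, toQuadraticForm'_eq_wsq,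
    LinearMap.sub_apply, predStateLin_apply]
  rfl

lemma ocpForm_nonneg (hQ : S.Q.PosSemidef) (hR : S.R.PosSemidef) (hP : S.P.PosSemidef)
    (p : ((Fin nx → ℝ) × (Fin nz → ℝ)) × (Fin N → Fin nu → ℝ)) : 0 ≤ S.ocpForm N p := by
  rw [ocpForm_apply]
  exact add_nonneg (wsq_nonneg hP _)
    (Finset.sum_nonneg fun i _ => add_nonneg (wsq_nonneg hQ _) (wsq_nonneg hR _))

lemma posDef_ocpForm_comp_inr (hQ : S.Q.PosSemidef) (hR : S.R.PosDef) (hP : S.P.PosSemidef) :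
    ((S.ocpForm N).comp (LinearMap.inr ℝ ((Fin nx → ℝ) × (Fin nz → ℝ)) _)).PosDef := by
  intro μ hμ
  obtain ⟨i, hi⟩ := Function.ne_iff.1 hμ
  rw [QuadraticMap.comp_apply, ocpForm_apply]
  refine add_pos_of_nonneg_of_pos (wsq_nonneg hP _) (Finset.sum_pos'
    (fun i _ => add_nonneg (wsq_nonneg hQ _) (wsq_nonneg hR.posSemidef _))
    ⟨i, Finset.mem_univ i, add_pos_of_nonneg_of_pos (wsq_nonneg hQ _) (wsq_pos hR ?_)⟩)
  simpa [ubar] using hi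

lemma existsUnique_ocp (hQ : S.Q.PosSemidef) (hR : S.R.PosDef) (hP : S.P.PosSemidef)
    (hT : IsPolyhedron S.terminalSet) {x : Fin nx → ℝ} {v : Fin nz → ℝ} (h : (x, v) ∈ S.Gam N) :
    ∃! μ, IsMinimizer (S.ocpCost x v) (S.ocpFeasible N x v) μ := by
  have hfeasible : IsPolyhedron (S.ocpFeasible N x v) := (isPolyhedron_ocpGraph hT).fibre (x, v)
  have hunique := existsUnique_isMinimizer_quadratic (ocpForm_nonneg hQ hR.posSemidef hP)
    (posDef_ocpForm_comp_inr hQ hR hP) ((x, v), 0) hfeasible.convex hfeasible.isClosed h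
  simpa only [ocpForm_apply, LinearMap.inr_apply, Prod.mk_add_mk, add_zero, zero_add] using hunique

variable (S N) in
/-- The optimal value of the optimal control problem; a junk value outside `Gam N`. -/
def ocpValue (x : Fin nx → ℝ) (v : Fin nz → ℝ) : ℝ :=
  S.ocpCost x v (argmin (S.ocpCost x v) (S.ocpFeasible N x v))

lemma ocpValue_nonneg (hQ : S.Q.PosSemidef) (hR : S.R.PosSemidef) (hP : S.P.PosSemidef)
    (x : Fin nx → ℝ) (v : Fin nz → ℝ) : 0 ≤ S.ocpValue N x v := by
  rw [ocpValue, ← ocpForm_apply ((x, v), _)]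
  exact ocpForm_nonneg hQ hR hP _

lemma exists_ocpValue_le (hQ : S.Q.PosSemidef) (hR : S.R.PosDef) (hP : S.P.PosSemidef)
    (hT : IsPolyhedron S.terminalSet) :
    ∃ c, 0 < c ∧ ∀ p μ, μ ∈ S.ocpFeasible N p.1 p.2 → ∀ p' ∈ S.Gam N, ∀ η, 0 < η →
      S.ocpValue N p'.1 p'.2 ≤ (1 + η) * S.ocpCost p.1 p.2 μ
        + (1 + η⁻¹) * (c * ‖p' - p‖ ^ 2) := by
  obtain ⟨C, hC, hle⟩ := exists_quadraticForm_le (S.ocpForm N)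
  obtain ⟨L, hL, hlip⟩ := (isPolyhedron_ocpGraph (N := N) hT).image_fst_and_hasLipschitzFibres.2
  refine ⟨C * (1 + L) ^ 2, by positivity, fun p μ hμ p' ⟨μ₀, hμ₀⟩ η hη => ?_⟩
  obtain ⟨μ', hμ', hdist⟩ := hlip p μ hμ p' μ₀ hμ₀
  have hnorm : ‖(p' - p, μ' - μ)‖ ≤ (1 + L) * ‖p' - p‖ :=
    max_le (le_mul_of_one_le_left (norm_nonneg _) (by linarith))
      (hdist.trans (by gcongr; linarith))
  have hmin := argmin_isMinimizer (existsUnique_ocp hQ hR hP hT ⟨μ₀, hμ₀⟩).exists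
  calc S.ocpValue N p'.1 p'.2 ≤ S.ocpForm N ((p, μ) + (p' - p, μ' - μ)) := by
        rw [Prod.mk_add_mk, add_sub_cancel, add_sub_cancel, ocpForm_apply]
        exact hmin.2 hμ'
    _ ≤ (1 + η) * S.ocpForm N (p, μ) + (1 + η⁻¹) * S.ocpForm N (p' - p, μ' - μ) :=
      quadraticForm_add_le (ocpForm_nonneg hQ hR.posSemidef hP) hη _ _
    _ ≤ (1 + η) * S.ocpCost p.1 p.2 μ + (1 + η⁻¹) * (C * (1 + L) ^ 2 * ‖p' - p‖ ^ 2) := by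
      rw [ocpForm_apply, mul_assoc C, ← mul_pow]
      gcongr
      exact (hle _).trans (by gcongr)

lemma ocpCost_lqr_xbar {v : Fin nz → ℝ} (heq : S.A *ᵥ S.xbar v + S.B *ᵥ S.ubar v = S.xbar v) :
    S.ocpCost (S.xbar v) v (fun i : Fin N => S.lqrInput v (S.lqrState (S.xbar v) v i)) = 0 := by
  have hstate (j) : S.lqrState (S.xbar v) v j - S.xbar v = 0 := by
    rw [lqrState_sub_xbar heq, sub_self, Matrix.mulVec_zero]
  simp only [ocpCost, predState_lqr, lqrInput_sub_ubar, hstate, Matrix.mulVec_zero, neg_zero,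
    wsq_zero, Finset.sum_const_zero, add_zero]

end OptimalControl

section Shift

variable (S) in
/-- The stage cost `‖x - x̄_v‖²_Q + ‖u - ū_v‖²_R`. -/
def stageCost (x : Fin nx → ℝ) (v : Fin nz → ℝ) (u : Fin nu → ℝ) : ℝ :=
  wsq S.Q (x - S.xbar v) + wsq S.R (u - S.ubar v)

lemma stageCost_nonneg (hQ : S.Q.PosSemidef) (hR : S.R.PosSemidef) (x : Fin nx → ℝ)
    (v : Fin nz → ℝ) (u : Fin nu → ℝ) : 0 ≤ S.stageCost x v u :=
  add_nonneg (wsq_nonneg hQ _) (wsq_nonneg hR _)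

variable (S) in
/-- The input sequence shifted by one step and extended by the LQR law: the candidate at the
successor state that shows recursive feasibility and the decrease of the value. -/
def shift (x : Fin nx → ℝ) (v : Fin nz → ℝ) (μ : Fin (N + 1) → Fin nu → ℝ) :
    Fin (N + 1) → Fin nu → ℝ :=
  Fin.snoc (Fin.tail μ) (S.lqrInput v (S.predState x μ (Fin.last (N + 1))))

lemma predState_shift_castSucc (x : Fin nx → ℝ) (v : Fin nz → ℝ)
    (μ : Fin (N + 1) → Fin nu → ℝ) (i : Fin (N + 1)) :
    S.predState (S.A *ᵥ x + S.B *ᵥ μ 0) (S.shift x v μ) i.castSucc = S.predState x μ i.succ := by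
  rw [shift, predState_snoc, predState_tail]

lemma predState_shift_last (x : Fin nx → ℝ) (v : Fin nz → ℝ) (μ : Fin (N + 1) → Fin nu → ℝ) :
    S.predState (S.A *ᵥ x + S.B *ᵥ μ 0) (S.shift x v μ) (Fin.last (N + 1))
      = S.lqrState (S.predState x μ (Fin.last (N + 1))) v 1 := by
  rw [← Fin.succ_last, predState_succ, predState_shift_castSucc, shift, Fin.snoc_last,
    Fin.succ_last]
  rfl

lemma shift_mem_ocpFeasible {x : Fin nx → ℝ} {v : Fin nz → ℝ} {μ : Fin (N + 1) → Fin nu → ℝ}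
    (h : μ ∈ S.ocpFeasible (N + 1) x v) :
    S.shift x v μ ∈ S.ocpFeasible (N + 1) (S.A *ᵥ x + S.B *ᵥ μ 0) v := by
  refine ⟨fun i => ?_, ?_⟩
  · rw [predState_shift_castSucc]
    cases i using Fin.lastCases with
    | last =>
      rw [shift, Fin.snoc_last, Fin.succ_last]
      exact h.2.2 0
    | cast i =>
      rw [shift, Fin.snoc_castSucc, Fin.succ_castSucc]
      exact h.1 i.succ
  · rw [predState_shift_last]
    exact ⟨h.2.1, fun j => by simpa only [lqrState_add] using h.2.2 (1 + j)⟩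

lemma ocpCost_shift (hR : S.R.PosDef) (hP : S.P.PosSemidef) (hDARE : S.SolvesDARE)
    {v : Fin nz → ℝ} (heq : S.A *ᵥ S.xbar v + S.B *ᵥ S.ubar v = S.xbar v) (x : Fin nx → ℝ)
    (μ : Fin (N + 1) → Fin nu → ℝ) :
    S.ocpCost (S.A *ᵥ x + S.B *ᵥ μ 0) v (S.shift x v μ)
      + S.stageCost x v (μ 0) = S.ocpCost x v μ := by
  have hterminal := wsq_Acl_add_stageCost hR hP hDARE
    (S.predState x μ (Fin.last (N + 1)) - S.xbar v)
  rw [ocpCost, ocpCost, stageCost, ← hterminal, predState_shift_last, lqrState_sub_xbar heq,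
    pow_one, Fin.sum_univ_castSucc, Fin.sum_univ_succ]
  simp only [predState_shift_castSucc]
  simp only [Fin.succ_last, shift, Fin.snoc_last, Fin.snoc_castSucc, Fin.tail, Fin.castSucc_zero,
    predState_zero, Fin.succ_castSucc, lqrInput_sub_ubar]
  ring

end Shift

section Governor

lemma isPolyhedron_govFeasible (hε : S.ε < 1) (hT : IsPolyhedron S.terminalSet)
    (x : Fin nx → ℝ) : IsPolyhedron (S.govFeasible N x) :=
  (isPolyhedron_admissibleRefs hε).inter ((isPolyhedron_Gam hT).fibre x)

lemma govCost_eq (v : Fin nz → ℝ) :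
    S.govCost v = (1 : Matrix (Fin nz) (Fin nz) ℝ).toQuadraticForm'
      (-S.r + (LinearMap.id : (Fin nz → ℝ) →ₗ[ℝ] _) v) := by
  rw [govCost, enorm2_sq, LinearMap.id_apply, neg_add_eq_sub, toQuadraticForm'_eq_wsq]

lemma convexOn_govCost : ConvexOn ℝ Set.univ S.govCost := by
  have hnorm : ConvexOn ℝ Set.univ (enorm2 : (Fin nz → ℝ) → ℝ) :=
    convexOn_univ_norm.comp_linearMap (WithLp.linearEquiv 2 ℝ (Fin nz → ℝ)).symm.toLinearMap
  exact (hnorm.translate_left (-S.r)).pow (fun _ _ => norm_nonneg _) 2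

lemma existsUnique_isMinimizer_govCost {s : Set (Fin nz → ℝ)} (hs : IsPolyhedron s)
    (hne : s.Nonempty) : ∃! v, IsMinimizer S.govCost s v := by
  have hone := posDef_toQuadraticForm' (.one (n := Fin nz))
  rw [funext govCost_eq]
  exact existsUnique_isMinimizer_quadratic (l := LinearMap.id) hone.nonneg hone _ hs.convex
    hs.isClosed hne

lemma norm_sub_sq_le_govCost_sub {s : Set (Fin nz → ℝ)} (hs : Convex ℝ s) {a b : Fin nz → ℝ}
    (ha : IsMinimizer S.govCost s a) (hb : b ∈ s) :
    ‖b - a‖ ^ 2 ≤ S.govCost b - S.govCost a := by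
  rw [funext govCost_eq] at ha
  rw [govCost_eq, govCost_eq]
  refine le_trans ?_ (isMinimizer_quadratic_gain hs ha hb)
  rw [LinearMap.id_apply, toQuadraticForm'_eq_wsq]
  exact norm_sq_le_wsq_one _

lemma isMinimizer_enorm2_iff {s : Set (Fin nz → ℝ)} {v : Fin nz → ℝ} :
    IsMinimizer (fun v => enorm2 (v - S.r)) s v ↔ IsMinimizer S.govCost s v :=
  and_congr_right fun _ => forall₂_congr fun _ _ =>
    (sq_le_sq₀ (norm_nonneg _) (norm_nonneg _)).symm

lemma existsUnique_isMinimizer_enorm2 (hε : S.ε < 1) (hY : (0 : Fin ny → ℝ) ∈ S.constraintSet) :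
    ∃! v, IsMinimizer (fun v => enorm2 (v - S.r)) S.admissibleRefs v := by
  simpa only [isMinimizer_enorm2_iff] using existsUnique_isMinimizer_govCost
    (isPolyhedron_admissibleRefs hε) ⟨0, zero_mem_admissibleRefs hY⟩

lemma isMinimizer_govCost_admissibleRefs_iff (hε : S.ε < 1)
    (hY : (0 : Fin ny → ℝ) ∈ S.constraintSet) {v : Fin nz → ℝ} :
    IsMinimizer S.govCost S.admissibleRefs v ↔ v = S.rStar := by
  have hunique := existsUnique_isMinimizer_enorm2 hε hY
  have hrStar : IsMinimizer _ _ S.rStar := argmin_isMinimizer hunique.exists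
  rw [← isMinimizer_enorm2_iff]
  exact ⟨fun hv => hunique.unique hv hrStar, fun hv => hv ▸ hrStar⟩

lemma isMinimizer_govCost_admissibleRefs_of_norm_lt (hε : S.ε < 1) {r : ℝ}
    (hterm : ∀ v ∈ S.admissibleRefs, ∀ x, ‖x - S.xbar v‖ ≤ r → (x, v) ∈ S.terminalSet)
    {x : Fin nx → ℝ} {v : Fin nz → ℝ} (hv : IsMinimizer S.govCost (S.govFeasible N x) v)
    (hx : ‖x - S.xbar v‖ < r) : IsMinimizer S.govCost S.admissibleRefs v := by
  have hcont : Continuous fun w => ‖x - S.xbar w‖ :=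
    (continuous_const.sub (continuous_const.matrix_mulVec continuous_id)).norm
  have hlocal : IsLocalMinOn S.govCost S.admissibleRefs v := by
    filter_upwards [self_mem_nhdsWithin,
      nhdsWithin_le_nhds ((hcont.tendsto v).eventually_lt_const hx)] with w hw hwx
    exact hv.2 ⟨hw, terminalSet_subset_Gam (hterm w hw x hwx.le)⟩
  exact ⟨hv.1.1, .of_isLocalMinOn_of_convexOn hv.1.1 hlocal
    (convexOn_govCost.subset (Set.subset_univ _) (isPolyhedron_admissibleRefs hε).convex)⟩

end Governor

section MPC

lemma exists_ocpValue_le_norm_sq (heq : ∀ v, S.A *ᵥ S.xbar v + S.B *ᵥ S.ubar v = S.xbar v)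
    (hQ : S.Q.PosSemidef) (hR : S.R.PosDef) (hP : S.P.PosSemidef)
    (hT : IsPolyhedron S.terminalSet)
    (hterm : ∀ v ∈ S.admissibleRefs, (S.xbar v, v) ∈ S.terminalSet) :
    ∃ c, 0 < c ∧ ∀ x, ∀ v ∈ S.govFeasible N x, S.ocpValue N x v ≤ c * ‖x - S.xbar v‖ ^ 2 := by
  obtain ⟨c, hc, hval⟩ := exists_ocpValue_le (N := N) hQ hR hP hT
  refine ⟨2 * c, by positivity, fun x v hv => ?_⟩
  have h := hval (S.xbar v, v) _ (lqr_mem_ocpFeasible (hterm v hv.1)) (x, v) hv.2 1 one_pos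
  rw [ocpCost_lqr_xbar (heq v), Prod.mk_sub_mk, sub_self, Prod.norm_mk, norm_zero,
    max_eq_left (norm_nonneg _)] at h
  norm_num at h
  linarith

variable [NeZero N]

lemma exists_mem_ocpFeasible_step (heq : ∀ v, S.A *ᵥ S.xbar v + S.B *ᵥ S.ubar v = S.xbar v)
    (hQ : S.Q.PosSemidef) (hR : S.R.PosDef) (hP : S.P.PosSemidef) (hDARE : S.SolvesDARE)
    (hT : IsPolyhedron S.terminalSet) {x : Fin nx → ℝ} {v : Fin nz → ℝ} (h : (x, v) ∈ S.Gam N) :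
    ∃ μ ∈ S.ocpFeasible N (S.step N x v) v,
      S.ocpCost (S.step N x v) v μ + S.stageCost x v (S.mpc N x v) = S.ocpValue N x v := by
  obtain ⟨n, rfl⟩ := Nat.exists_eq_succ_of_ne_zero (NeZero.ne N)
  have hmin := argmin_isMinimizer (existsUnique_ocp hQ hR hP hT h).exists
  exact ⟨_, shift_mem_ocpFeasible hmin.1, ocpCost_shift hR hP hDARE (heq v) x _⟩

lemma mem_govFeasible_step (heq : ∀ v, S.A *ᵥ S.xbar v + S.B *ᵥ S.ubar v = S.xbar v)
    (hQ : S.Q.PosSemidef) (hR : S.R.PosDef) (hP : S.P.PosSemidef) (hDARE : S.SolvesDARE)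
    (hT : IsPolyhedron S.terminalSet) {x : Fin nx → ℝ} {v : Fin nz → ℝ}
    (h : v ∈ S.govFeasible N x) : v ∈ S.govFeasible N (S.step N x v) :=
  let ⟨μ, hμ, _⟩ := exists_mem_ocpFeasible_step heq hQ hR hP hDARE hT h.2
  ⟨h.1, μ, hμ⟩

lemma exists_ocpValue_step_le (heq : ∀ v, S.A *ᵥ S.xbar v + S.B *ᵥ S.ubar v = S.xbar v)
    (hQ : S.Q.PosSemidef) (hR : S.R.PosDef) (hP : S.P.PosSemidef) (hDARE : S.SolvesDARE)
    (hT : IsPolyhedron S.terminalSet)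
    (hterm : ∀ v ∈ S.admissibleRefs, (S.xbar v, v) ∈ S.terminalSet) {η : ℝ} (hη : 0 < η) :
    ∃ c, 0 < c ∧ ∀ x, ∀ v ∈ S.govFeasible N x, ∀ v' ∈ S.govFeasible N (S.step N x v),
      S.ocpValue N (S.step N x v) v' + S.stageCost x v (S.mpc N x v)
        ≤ S.ocpValue N x v + η * ‖x - S.xbar v‖ ^ 2 + c * ‖v' - v‖ ^ 2 := by
  obtain ⟨b, hb, hbound⟩ := exists_ocpValue_le_norm_sq (N := N) heq hQ hR hP hT hterm
  obtain ⟨c, hc, hval⟩ := exists_ocpValue_le (N := N) hQ hR hP hT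
  refine ⟨(1 + (η / b)⁻¹) * c, by positivity, fun x v hv v' hv' => ?_⟩
  obtain ⟨μ, hμ, hcost⟩ := exists_mem_ocpFeasible_step heq hQ hR hP hDARE hT hv.2
  have hstep := hval (S.step N x v, v) μ hμ (S.step N x v, v') hv'.2 (η / b) (by positivity)
  rw [Prod.mk_sub_mk, sub_self, Prod.norm_mk, norm_zero, max_eq_right (norm_nonneg _),
    ← mul_assoc, eq_sub_of_add_eq hcost] at hstep
  have hstage := mul_nonneg (div_pos hη hb).le
    (stageCost_nonneg hQ hR.posSemidef x v (S.mpc N x v))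
  have hsmall : η / b * S.ocpValue N x v ≤ η * ‖x - S.xbar v‖ ^ 2 := by
    rw [div_mul_eq_mul_div, div_le_iff₀ hb, mul_assoc, mul_comm _ b]
    gcongr
    exact hbound x v hv
  linarith

lemma step_sub_xbar (heq : ∀ v, S.A *ᵥ S.xbar v + S.B *ᵥ S.ubar v = S.xbar v) (x : Fin nx → ℝ)
    (v v' : Fin nz → ℝ) :
    S.step N x v - S.xbar v'
      = S.A *ᵥ (x - S.xbar v) + S.B *ᵥ (S.mpc N x v - S.ubar v) + (-S.Gx) *ᵥ (v' - v) := by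
  rw [← mulVec_add_mulVec_sub_xbar (heq v), step, Matrix.neg_mulVec, Matrix.mulVec_sub, ← xbar,
    ← xbar]
  abel

/-- The optimal value decreases by the stage cost, which need not dominate `‖x - x̄_v‖²`; adding
a storage function of the stage cost makes up for that. -/
lemma exists_lyapunov (heq : ∀ v, S.A *ᵥ S.xbar v + S.B *ᵥ S.ubar v = S.xbar v)
    (hQ : S.Q.PosSemidef) (hdet : IsDetectable S.A S.Q) (hR : S.R.PosDef)
    (hP : S.P.PosSemidef) (hDARE : S.SolvesDARE) (hT : IsPolyhedron S.terminalSet)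
    (hterm : ∀ v ∈ S.admissibleRefs, (S.xbar v, v) ∈ S.terminalSet) :
    ∃ (W : (Fin nx → ℝ) → (Fin nz → ℝ) → ℝ) (c : ℝ), 0 < c ∧ (∀ x v, 0 ≤ W x v) ∧
      ∀ x, ∀ v ∈ S.govFeasible N x, ∀ v' ∈ S.govFeasible N (S.step N x v),
        W (S.step N x v) v' + ‖x - S.xbar v‖ ^ 2 / 4 ≤ W x v + c * ‖v' - v‖ ^ 2 := by
  obtain ⟨V, C, c, hC, hc, hV, hstorage⟩ := hdet.exists_storageForm_add hQ S.B hR (-S.Gx)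
  obtain ⟨c', hc', hvalue⟩ := exists_ocpValue_step_le (N := N) heq hQ hR hP hDARE hT hterm
    (η := (4 * C)⁻¹) (by positivity)
  refine ⟨fun x v => C * S.ocpValue N x v + V (x - S.xbar v), C * c' + c, by positivity,
    fun x v => add_nonneg (mul_nonneg hC.le (ocpValue_nonneg hQ hR.posSemidef hP x v)) (hV _),
    fun x v hv v' hv' => ?_⟩
  have hV' := hstorage (x - S.xbar v) (S.mpc N x v - S.ubar v) (v' - v)
  rw [← step_sub_xbar heq, ← stageCost] at hV'
  have hvalue' := mul_le_mul_of_nonneg_left (hvalue x v hv v' hv') hC.le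
  have hη : C * ((4 * C)⁻¹ * ‖x - S.xbar v‖ ^ 2) = ‖x - S.xbar v‖ ^ 2 / 4 := by
    field_simp
  linarith

end MPC

section ClosedLoop

variable [NeZero N] {x₀ : Fin nx → ℝ}

lemma existsUnique_gov (heq : ∀ v, S.A *ᵥ S.xbar v + S.B *ᵥ S.ubar v = S.xbar v)
    (hε : S.ε < 1) (hQ : S.Q.PosSemidef) (hR : S.R.PosDef) (hP : S.P.PosSemidef)
    (hDARE : S.SolvesDARE) (hT : IsPolyhedron S.terminalSet)
    (hx₀ : (S.govFeasible N x₀).Nonempty) (k : ℕ) :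
    ∃! v, IsMinimizer S.govCost (S.govFeasible N (S.stateSeq N x₀ k)) v := by
  refine existsUnique_isMinimizer_govCost (isPolyhedron_govFeasible hε hT _) ?_
  induction k with
  | zero => exact hx₀
  | succ k ih =>
    have hunique :=
      existsUnique_isMinimizer_govCost (S := S) (isPolyhedron_govFeasible hε hT _) ih
    exact ⟨_, mem_govFeasible_step heq hQ hR hP hDARE hT (argmin_isMinimizer hunique.exists).1⟩

lemma isMinimizer_refSeq (heq : ∀ v, S.A *ᵥ S.xbar v + S.B *ᵥ S.ubar v = S.xbar v)
    (hε : S.ε < 1) (hQ : S.Q.PosSemidef) (hR : S.R.PosDef) (hP : S.P.PosSemidef)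
    (hDARE : S.SolvesDARE) (hT : IsPolyhedron S.terminalSet)
    (hx₀ : (S.govFeasible N x₀).Nonempty) (k : ℕ) :
    IsMinimizer S.govCost (S.govFeasible N (S.stateSeq N x₀ k)) (S.refSeq N x₀ k) :=
  argmin_isMinimizer (existsUnique_gov heq hε hQ hR hP hDARE hT hx₀ k).exists

lemma refSeq_mem_govFeasible_succ (heq : ∀ v, S.A *ᵥ S.xbar v + S.B *ᵥ S.ubar v = S.xbar v)
    (hε : S.ε < 1) (hQ : S.Q.PosSemidef) (hR : S.R.PosDef) (hP : S.P.PosSemidef)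
    (hDARE : S.SolvesDARE) (hT : IsPolyhedron S.terminalSet)
    (hx₀ : (S.govFeasible N x₀).Nonempty) (k : ℕ) :
    S.refSeq N x₀ k ∈ S.govFeasible N (S.stateSeq N x₀ (k + 1)) :=
  mem_govFeasible_step heq hQ hR hP hDARE hT
    (isMinimizer_refSeq heq hε hQ hR hP hDARE hT hx₀ k).1

lemma tendsto_stateSeq_sub_xbar_refSeq
    (heq : ∀ v, S.A *ᵥ S.xbar v + S.B *ᵥ S.ubar v = S.xbar v)
    (hε : S.ε < 1) (hQ : S.Q.PosSemidef) (hdet : IsDetectable S.A S.Q) (hR : S.R.PosDef)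
    (hP : S.P.PosSemidef) (hDARE : S.SolvesDARE) (hT : IsPolyhedron S.terminalSet)
    (hterm : ∀ v ∈ S.admissibleRefs, (S.xbar v, v) ∈ S.terminalSet)
    (hx₀ : (S.govFeasible N x₀).Nonempty) :
    Tendsto (fun k => S.stateSeq N x₀ k - S.xbar (S.refSeq N x₀ k)) atTop (𝓝 0) := by
  obtain ⟨W, c, hc, hW, hdec⟩ := exists_lyapunov (N := N) heq hQ hdet hR hP hDARE hT hterm
  have hmin := isMinimizer_refSeq heq hε hQ hR hP hDARE hT hx₀
  have hquarter : Tendsto (fun k => ‖S.stateSeq N x₀ k - S.xbar (S.refSeq N x₀ k)‖ ^ 2 / 4)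
      atTop (𝓝 0) := by
    refine tendsto_zero_of_forall_add_le
      (f := fun k => W (S.stateSeq N x₀ k) (S.refSeq N x₀ k) + c * S.govCost (S.refSeq N x₀ k))
      (fun k => add_nonneg (hW _ _) (mul_nonneg hc.le (sq_nonneg _))) (fun k => by positivity)
      fun k => ?_
    have hgain := norm_sub_sq_le_govCost_sub (isPolyhedron_govFeasible hε hT _).convex
      (hmin (k + 1)) (refSeq_mem_govFeasible_succ heq hε hQ hR hP hDARE hT hx₀ k)
    have hscaled := mul_le_mul_of_nonneg_left hgain hc.le
    have hstep := hdec _ _ (hmin k).1 _ (hmin (k + 1)).1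
    rw [norm_sub_rev] at hscaled
    rw [stateSeq, ← refSeq]
    linarith
  rw [tendsto_zero_iff_norm_tendsto_zero]
  simpa using (hquarter.mul_const 4).sqrt

end ClosedLoop

end Setup

end FeasGov

end

open FeasGov Setup in
theorem theorem4_general {nx nu ny nz m : ℕ} (S : Setup nx nu ny nz m)
    (N : ℕ) [NeZero N]
    (heq : ∀ v, S.A *ᵥ S.xbar v + S.B *ᵥ S.ubar v = S.xbar v)
    (hε : S.ε ∈ Set.Ioo (0 : ℝ) 1)
    (hYcompact : IsCompact S.constraintSet)
    (hYzero : (0 : Fin ny → ℝ) ∈ interior S.constraintSet)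
    (hQ : S.Q.PosSemidef)
    (hdet : IsDetectable S.A S.Q)
    (hR : S.R.PosDef)
    (hP : S.P.PosSemidef)
    (hDARE : S.SolvesDARE) :
    (∃! v, IsMinimizer (fun v => enorm2 (v - S.r)) S.admissibleRefs v) ∧
    ∀ x₀ ∈ Prod.fst '' S.Lam N,
      (∀ k : ℕ,
        (∃! v, IsMinimizer S.govCost (S.govFeasible N (S.stateSeq N x₀ k)) v) ∧
        (∃! μ, IsMinimizer (S.ocpCost (S.stateSeq N x₀ k) (S.refSeq N x₀ k))
          (S.ocpFeasible N (S.stateSeq N x₀ k) (S.refSeq N x₀ k)) μ)) ∧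
      ∃ t : ℕ, ∀ k ≥ t, S.refSeq N x₀ k = S.rStar := by
  have hY := interior_subset hYzero
  have hAcl := tendsto_Acl_pow hQ hdet hR hP hDARE
  have hT := isPolyhedron_terminalSet heq hAcl hε hYcompact hYzero
  obtain ⟨r, hr, hterm⟩ := exists_forall_mem_terminalSet heq hAcl hε hYzero
  refine ⟨existsUnique_isMinimizer_enorm2 hε.2 hY, ?_⟩
  rintro _ ⟨⟨x₀, v₀⟩, ⟨hfeasible, -, hadmissible⟩, rfl⟩
  have hx₀ : (S.govFeasible N x₀).Nonempty := ⟨v₀, hadmissible, hfeasible⟩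
  have hmin := isMinimizer_refSeq heq hε.2 hQ hR hP hDARE hT hx₀
  refine ⟨fun k => ⟨existsUnique_gov heq hε.2 hQ hR hP hDARE hT hx₀ k,
    existsUnique_ocp hQ hR hP hT (hmin k).1.2⟩, Filter.eventually_atTop.1 ?_⟩
  have hlimit := tendsto_stateSeq_sub_xbar_refSeq heq hε.2 hQ hdet hR hP hDARE hT
    (fun v hv => hterm v hv _ (by simpa using hr.le)) hx₀
  filter_upwards [(tendsto_zero_iff_norm_tendsto_zero.1 hlimit).eventually_lt_const hr] with k hk
  exact (isMinimizer_govCost_admissibleRefs_iff hε.2 hY).1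
    (isMinimizer_govCost_admissibleRefs_of_norm_lt hε.2 hterm (hmin k) hk)

theorem theorem4 {nx nu ny nz m : ℕ} (S : FeasGov.Setup nx nu ny nz m)
    (N : ℕ) [NeZero N]
    (hG : S.IsEquilibriumBasis)
    (hε : S.ε ∈ Set.Ioo (0 : ℝ) 1)
    (hstab : FeasGov.IsStabilizable S.A S.B)
    (hGz : IsUnit S.Gz)
    (hYcompact : IsCompact S.constraintSet)
    (hYzero : (0 : Fin ny → ℝ) ∈ interior S.constraintSet)
    (hQ : S.Q.PosSemidef)
    (hdet : FeasGov.IsDetectable S.A S.Q)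
    (hR : S.R.PosDef)
    (hP : S.P.PosSemidef)
    (hDARE : S.SolvesDARE) :
    -- the reference `r⋆` is well defined
    (∃! v, FeasGov.IsMinimizer (fun v => FeasGov.enorm2 (v - S.r)) S.admissibleRefs v) ∧
    ∀ x₀ ∈ Prod.fst '' S.Lam N,
      -- the closed loop is well defined: both optimization problems have unique solutions
      (∀ k : ℕ,
        (∃! v, FeasGov.IsMinimizer S.govCost (S.govFeasible N (S.stateSeq N x₀ k)) v) ∧
        (∃! μ, FeasGov.IsMinimizer (S.ocpCost (S.stateSeq N x₀ k) (S.refSeq N x₀ k))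
          (S.ocpFeasible N (S.stateSeq N x₀ k) (S.refSeq N x₀ k)) μ)) ∧
      -- finite-time convergence
      ∃ t : ℕ, ∀ k ≥ t, S.refSeq N x₀ k = S.rStar := by
  exact theorem4_general S N (FeasGov.Setup.mulVec_xbar_add_mulVec_ubar hG) hε hYcompact hYzero
    hQ hdet hR hP hDARE
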